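/- **Setting.** Let $A=[a_{ij}]$ be a $d\times n$ integer matrix of rank $d$ whose columns all lie in one hyperplane of $\mathbb Q^d$ not passing through the origin, let $\beta\in\mathbb C^d$, and put $L=\mathrm{Ker}_{\mathbb Z}A\subset\mathbb Z^n$. Let $I_A=\langle\partial_x^{a}-\partial_x^{b}\mid Aa=Ab,\ a,b\in\mathbb N^n\rangle\subset\mathbb C[\partial_1,\dots,\partial_n]$ be the toric ideal, and let $H_A(\beta)$ be the left ideal of the Weyl algebra $D=\mathbb C\langle x,\partial_x\rangle$ generated by $I_A$ and the operators $\sum_j a_{ij}x_j\partial_j-\beta_i$ $(1\le i\le d)$. A formal series $\sum_\alpha r_\alpha(\log x)\,x^\alpha$ ($\alpha\in\mathbb C^n$, $r_\alpha\in\mathbb C[y_1,\dots,y_n]$) annihilated by $H_A(\beta)$ is called $A$-hypergeometric. For $c\in\mathbb C^n$ and $m\in\mathbb N^n$ put $[c]_m=\prod_j c_j(c_j-1)\cdots(c_j-m_j+1)$. Let $w\in\mathbb R^n$ be a generic weight (the initial ideal $\mathrm{in}_w(I_A)$, generated by the parts of highest $w$-weight of its elements, is a monomial ideal), and let $v_0\in\mathbb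 C^n$ be a fake exponent, i.e. $Av_0=\beta$ and $[v_0]_m=0$ whenever $\partial_x^m\in\mathrm{in}_w(I_A)$. For $v\in\mathbb C^n$ let $\mathrm{nsupp}(v)=\{j\mid v_j\in\mathbb Z_{<0}\}$. Put $\mathrm{NS}=\{\mathrm{nsupp}(v_0+u)\mid u\in L\}$ and let $\mathcal N$ be the set of all $I\in\mathrm{NS}$ such that $\min\{w\cdot u\mid u\in L,\ \mathrm{nsupp}(v_0+u)=I\}$ exists. Let $v\in v_0+L$ be a minimal $w$-weight vector, i.e. $w\cdot(v-v_0)$ is the minimum of $w\cdot(v'-v_0)$ over all $v'\in v_0+L$ with $\mathrm{nsupp}(v')=\mathrm{nsupp}(v)$. Let $\mathcal N'\subset\mathcal N$ be any subset, $(\mathcal N')^c=\mathrm{NS}\setminus\mathcal N'$, $K=K_{\mathcal N'}=\bigcap_{I\in\mathcal N'}I$, and $I_u=\mathrm{nsupp}(v+u)$ for $u\in L$. For $J\subset\{1,\dots,n\}$ write $t^J=\prod_{j\in J}t_j$. In $\mathbb C[[t]]=\mathbb C[[t_1,\dots,t_n]]$ put $$P_{\mathcal N'}(t)=\langle t^{(I\cup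 J)\setminus K}\mid I\in\mathcal N',\ J\in(\mathcal N')^c\rangle,$$ $$Q_{\mathcal N'}(t)=\langle (At)_i\,t^{I\setminus K}\mid 1\le i\le d,\ I\in\mathcal N'\rangle+P_{\mathcal N'}(t),\qquad (At)_i=\sum_j a_{ij}t_j .$$ For an ideal $P\subset\mathbb C[[t]]$ let $P^\perp=\{q\in\mathbb C[\partial_t]\mid (q(\partial_t)\bullet p(t))|_{t=0}=0\ \text{for all }p\in P\}$. With $u=u_+-u_-$ ($u_\pm\in\mathbb N^n$ of disjoint supports), let $$a_u(t)=\frac{[v+t]_{u_-}}{[v+t+u]_{u_+}},\qquad \tilde F_{v,\mathcal N'}(x,t)=t^{I_0\setminus K}\sum_{u\in L,\ I_u\in\mathcal N'}a_u(t)\,x^{v+t+u},$$ where $x^{t}=\exp(\sum_j t_j\log x_j)$; each $t^{I_0\setminus K}a_u(t)$ occurring here is a power series in $t$, and $q(\partial_t)$ and $t=0$ are applied term by term. **Theorem.** 1. $Q_{\mathcal N'}(t)^\perp=\langle (At)_i\,t^{I\setminus K}\mid 1\le i\le d,\ I\in\mathcal N'\rangle^\perp\cap P_{\mathcal N'}(t)^\perp$,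 and for every $q\in Q_{\mathcal N'}(t)^\perp$ the series $(q(\partial_t)\bullet\tilde F_{v,\mathcal N'}(x,t))|_{t=0}$ is $A$-hypergeometric with parameter $\beta$. 2. If $I_0=\mathrm{nsupp}(v)\in\mathcal N'$, then the set of coefficients of $x^v$ in the series $(q(\partial_t)\bullet\tilde F_{v,\mathcal N'}(x,t))|_{t=0}$, $q\in Q_{\mathcal N'}(t)^\perp$, is exactly $$\{\,r(\log x)\mid r\in(Q_{\mathcal N'}(t):t^{I_0\setminus K})^\perp\,\},$$ where $r(\log x)$ is obtained from $r(\partial_t)$ by replacing each $\partial_{t_j}$ by $\log x_j$. -/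

import Mathlib

noncomputable section

namespace AHyp

open Classical in
/-- The negative support `{j | v_j ∈ ℤ_{<0}}` of a vector `v ∈ ℂⁿ`. -/
def nsupp {n : ℕ} (v : Fin n → ℂ) : Finset (Fin n) :=
  Finset.univ.filter fun j => ∃ k : ℤ, k < 0 ∧ v j = (k : ℂ)

/-- The lattice `L = Ker_ℤ A`. -/
def lattice {d n : ℕ} (A : Matrix (Fin d) (Fin n) ℤ) : Set (Fin n → ℤ) :=
  {u | A.mulVec u = 0}

/-- The vector `v + u` for `v ∈ ℂⁿ` and `u ∈ ℤⁿ`. -/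
def shift {n : ℕ} (v : Fin n → ℂ) (u : Fin n → ℤ) : Fin n → ℂ := fun j => v j + (u j : ℂ)

/-- The positive part `u₊`. -/
def uPlus {n : ℕ} (u : Fin n → ℤ) : Fin n → ℕ := fun j => (u j).toNat

/-- The negative part `u₋`, so that `u = u₊ - u₋`. -/
def uMinus {n : ℕ} (u : Fin n → ℤ) : Fin n → ℕ := fun j => (-u j).toNat

/-- The columns of `A` lie in one hyperplane of `ℚᵈ` not passing through the origin. -/
def IsHomogeneous {d n : ℕ} (A : Matrix (Fin d) (Fin n) ℤ) : Prop :=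
  ∃ c : Fin d → ℚ, ∀ j, ∑ i, c i * (A i j : ℚ) = 1

/-! ### Toric ideal, initial ideal, fake exponents -/

/-- The toric ideal `I_A` in `ℂ[∂_1, …, ∂_n]`. -/
def toricIdeal {d n : ℕ} (A : Matrix (Fin d) (Fin n) ℤ) : Ideal (MvPolynomial (Fin n) ℂ) :=
  Ideal.span {p | ∃ a b : Fin n →₀ ℕ,
    A.mulVec (fun j => (a j : ℤ)) = A.mulVec (fun j => (b j : ℤ)) ∧
    p = MvPolynomial.monomial a 1 - MvPolynomial.monomial b 1}

/-- The initial ideal `in_w(I)`, generated by the initial forms (the parts of highest `w`-weight)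
of the elements of `I`. -/
def initialIdeal {n : ℕ} (w : Fin n → ℝ) (I : Ideal (MvPolynomial (Fin n) ℂ)) :
    Ideal (MvPolynomial (Fin n) ℂ) :=
  Ideal.span {g | ∃ f ∈ I, ∃ c : ℝ, (∀ m ∈ f.support, Finsupp.weight w m ≤ c) ∧
    g = MvPolynomial.weightedHomogeneousComponent w c f}

/-- `w` is generic for `A`: the initial ideal `in_w(I_A)` is a monomial ideal. -/
def IsGenericWeight {d n : ℕ} (A : Matrix (Fin d) (Fin n) ℤ) (w : Fin n → ℝ) : Prop :=
  ∃ S : Set (Fin n →₀ ℕ), initialIdeal w (toricIdeal A) =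
    Ideal.span ((fun m => MvPolynomial.monomial m (1 : ℂ)) '' S)

/-- `v` is a fake exponent of `H_A(β)` in direction `w`, i.e. a zero of the fake indicial ideal
generated by `Aθ - β` and the `[θ]_m` with `∂^m ∈ in_w(I_A)`, where
`[θ]_m = ∏_j θ_j (θ_j - 1) ⋯ (θ_j - m_j + 1)`. -/
def IsFakeExponent {d n : ℕ} (A : Matrix (Fin d) (Fin n) ℤ) (β : Fin d → ℂ) (w : Fin n → ℝ)
    (v : Fin n → ℂ) : Prop :=
  (∀ i, ∑ j, (A i j : ℂ) * v j = β i) ∧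
  ∀ m : Fin n →₀ ℕ, MvPolynomial.monomial m (1 : ℂ) ∈ initialIdeal w (toricIdeal A) →
    ∏ j, ∏ k ∈ Finset.range (m j), (v j - (k : ℂ)) = 0

/-! ### Negative supports and minimal vectors -/

/-- `NS = {nsupp (v₀ + u) | u ∈ L}`. -/
def NS {d n : ℕ} (A : Matrix (Fin d) (Fin n) ℤ) (v₀ : Fin n → ℂ) : Set (Finset (Fin n)) :=
  {I | ∃ u ∈ lattice A, nsupp (shift v₀ u) = I}

/-- The pairing `w · u`. -/
def wdot {n : ℕ} (w : Fin n → ℝ) (u : Fin n → ℤ) : ℝ := ∑ j, w j * (u j : ℝ)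

/-- The set `𝒩` of those `I ∈ NS` for which
`min {w · u | I = nsupp (v₀ + u), u ∈ L}` exists. -/
def minNS {d n : ℕ} (A : Matrix (Fin d) (Fin n) ℤ) (w : Fin n → ℝ) (v₀ : Fin n → ℂ) :
    Set (Finset (Fin n)) :=
  {I | I ∈ NS A v₀ ∧
    ∃ c : ℝ, IsLeast {r | ∃ u ∈ lattice A, nsupp (shift v₀ u) = I ∧ r = wdot w u} c}

/-- `v ∈ v₀ + L` is a minimal `w`-weight vector: `w · (v - v₀)` is the minimum of the
`w · (v' - v₀)` over the `v' ∈ v₀ + L` with the same negative support as `v`. -/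
def IsMinimalWeightVector {d n : ℕ} (A : Matrix (Fin d) (Fin n) ℤ) (w : Fin n → ℝ)
    (v₀ v : Fin n → ℂ) : Prop :=
  ∃ u₀ ∈ lattice A, v = shift v₀ u₀ ∧
    IsLeast {r | ∃ u ∈ lattice A, nsupp (shift v₀ u) = nsupp v ∧ r = wdot w u} (wdot w u₀)

open Classical in
/-- `K_{𝒩'} = ⋂_{I ∈ 𝒩'} I`. -/
def commonPart {n : ℕ} (N' : Set (Finset (Fin n))) : Finset (Fin n) :=
  Finset.univ.filter fun j => ∀ I ∈ N', j ∈ I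

/-! ### The duality between differential operators and power series -/

/-- The operator `∂_t^m` on power series in `t` over a commutative ring `R`. -/
def monoDiff {n : ℕ} (R : Type*) [CommRing R] (m : Fin n →₀ ℕ) :
    Module.End R (MvPowerSeries (Fin n) R) :=
  (List.ofFn fun j =>
    ((MvPowerSeries.pderiv R j).toLinearMap : Module.End R (MvPowerSeries (Fin n) R)) ^ m j).prod

/-- `q(∂_t) • p(t)` for `q ∈ ℂ[∂_t]` and a power series `p` in `t` with coefficients in a
commutative `ℂ`-algebra `R`. -/
def applyDiff {n : ℕ} {R : Type*} [CommRing R] [Algebra ℂ R]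
    (q : MvPolynomial (Fin n) ℂ) (p : MvPowerSeries (Fin n) R) : MvPowerSeries (Fin n) R :=
  ∑ m ∈ q.support, q.coeff m • monoDiff R m p

/-- `(q(∂_t) • p(t))|_{t = 0}`. -/
def evalDiff {n : ℕ} {R : Type*} [CommRing R] [Algebra ℂ R]
    (q : MvPolynomial (Fin n) ℂ) (p : MvPowerSeries (Fin n) R) : R :=
  MvPowerSeries.constantCoeff (applyDiff q p)

/-- `P^⊥ = {q ∈ ℂ[∂_t] | (q(∂_t) • p(t))|_{t = 0} = 0 for all p ∈ P}`. -/
def perp {n : ℕ} (P : Ideal (MvPowerSeries (Fin n) ℂ)) : Set (MvPolynomial (Fin n) ℂ) :=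
  {q | ∀ p ∈ P, evalDiff q p = 0}

/-- The squarefree monomial `t^J = ∏_{j ∈ J} t_j`. -/
def tpow {n : ℕ} (J : Finset (Fin n)) : MvPowerSeries (Fin n) ℂ := ∏ j ∈ J, MvPowerSeries.X j

/-- The linear form `(At)_i = ∑_j a_{ij} t_j`. -/
def linForm {d n : ℕ} (A : Matrix (Fin d) (Fin n) ℤ) (i : Fin d) : MvPowerSeries (Fin n) ℂ :=
  ∑ j, MvPowerSeries.C (A i j : ℂ) * MvPowerSeries.X j

/-- The ideal `⟨(At) t^{I ∖ K} | I ∈ 𝒩'⟩` of `ℂ[[t]]`. -/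
def eulerIdeal {d n : ℕ} (A : Matrix (Fin d) (Fin n) ℤ) (N' : Set (Finset (Fin n))) :
    Ideal (MvPowerSeries (Fin n) ℂ) :=
  Ideal.span {p | ∃ i : Fin d, ∃ I ∈ N', p = linForm A i * tpow (I \ commonPart N')}

/-- The ideal `P_{𝒩'}(t) = ⟨t^{(I ∪ J) ∖ K} | I ∈ 𝒩', J ∈ NS ∖ 𝒩'⟩` of `ℂ[[t]]`. -/
def idealP {d n : ℕ} (A : Matrix (Fin d) (Fin n) ℤ) (v₀ : Fin n → ℂ)
    (N' : Set (Finset (Fin n))) : Ideal (MvPowerSeries (Fin n) ℂ) :=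
  Ideal.span {p | ∃ I ∈ N', ∃ J ∈ NS A v₀ \ N', p = tpow ((I ∪ J) \ commonPart N')}

/-- The ideal `Q_{𝒩'}(t)`. -/
def idealQ {d n : ℕ} (A : Matrix (Fin d) (Fin n) ℤ) (v₀ : Fin n → ℂ)
    (N' : Set (Finset (Fin n))) : Ideal (MvPowerSeries (Fin n) ℂ) :=
  eulerIdeal A N' ⊔ idealP A v₀ N'

/-! ### The Weyl algebra, the hypergeometric ideal and its action on logarithmic series -/

/-- The defining relations of the Weyl algebra; `Sum.inl j` stands for `x_j` and `Sum.inr j`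
for `∂_j`. -/
inductive WeylRel (n : ℕ) : FreeAlgebra ℂ (Fin n ⊕ Fin n) → FreeAlgebra ℂ (Fin n ⊕ Fin n) → Prop
  | xx (i j : Fin n) : WeylRel n
      (FreeAlgebra.ι ℂ (Sum.inl i) * FreeAlgebra.ι ℂ (Sum.inl j))
      (FreeAlgebra.ι ℂ (Sum.inl j) * FreeAlgebra.ι ℂ (Sum.inl i))
  | dd (i j : Fin n) : WeylRel n
      (FreeAlgebra.ι ℂ (Sum.inr i) * FreeAlgebra.ι ℂ (Sum.inr j))
      (FreeAlgebra.ι ℂ (Sum.inr j) * FreeAlgebra.ι ℂ (Sum.inr i))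
  | dx (i j : Fin n) : WeylRel n
      (FreeAlgebra.ι ℂ (Sum.inr i) * FreeAlgebra.ι ℂ (Sum.inl j))
      (FreeAlgebra.ι ℂ (Sum.inl j) * FreeAlgebra.ι ℂ (Sum.inr i) + if i = j then 1 else 0)

/-- The Weyl algebra `D = ℂ⟨x_1, …, x_n, ∂_1, …, ∂_n⟩`. -/
abbrev Weyl (n : ℕ) : Type := RingQuot (WeylRel n)

/-- The element `x_j` of the Weyl algebra. -/
def wx {n : ℕ} (j : Fin n) : Weyl n :=
  RingQuot.mkAlgHom ℂ (WeylRel n) (FreeAlgebra.ι ℂ (Sum.inl j))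

/-- The element `∂_j` of the Weyl algebra. -/
def wd {n : ℕ} (j : Fin n) : Weyl n :=
  RingQuot.mkAlgHom ℂ (WeylRel n) (FreeAlgebra.ι ℂ (Sum.inr j))

/-- The image `p(∂_x)` in the Weyl algebra of a polynomial `p ∈ ℂ[∂_1, …, ∂_n]`. -/
def polyD {n : ℕ} (p : MvPolynomial (Fin n) ℂ) : Weyl n :=
  ∑ m ∈ p.support, p.coeff m • (List.ofFn fun j => (wd j : Weyl n) ^ m j).prod

/-- The Euler operator `∑_j a_{ij} θ_j - β_i` with `θ_j = x_j ∂_j`. -/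
def eulerOp {d n : ℕ} (A : Matrix (Fin d) (Fin n) ℤ) (β : Fin d → ℂ) (i : Fin d) : Weyl n :=
  ∑ j, (A i j : ℂ) • (wx j * wd j) - algebraMap ℂ (Weyl n) (β i)

/-- The left ideal `H_A(β)` of the Weyl algebra. (`Ideal` means left ideal over a
noncommutative ring.) -/
def hypIdeal {d n : ℕ} (A : Matrix (Fin d) (Fin n) ℤ) (β : Fin d → ℂ) : Ideal (Weyl n) :=
  Ideal.span (polyD '' (toricIdeal A : Set (MvPolynomial (Fin n) ℂ)) ∪ Set.range (eulerOp A β))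

/-- Formal logarithmic series `∑_α r_α(log x) x^α` with `α ∈ ℂⁿ` and `r_α ∈ ℂ[y_1, …, y_n]`;
the series is the function `α ↦ r_α`. -/
abbrev LogSeries (n : ℕ) : Type := (Fin n → ℂ) → MvPolynomial (Fin n) ℂ

/-- Multiplication by `x_j`. -/
def mulX {n : ℕ} (j : Fin n) : Module.End ℂ (LogSeries n) where
  toFun φ α := φ (α - Pi.single j 1)
  map_add' φ ψ := by
    funext α
    rw [Pi.add_apply, Pi.add_apply]
  map_smul' c φ := by
    funext α
    rw [Pi.smul_apply, Pi.smul_apply, RingHom.id_apply]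

/-- The derivation `∂/∂x_j`, given on terms by
`∂_j • (r(log x) x^α) = ((∂_{y_j} + α_j) • r)(log x) x^{α - e_j}`. -/
def derivX {n : ℕ} (j : Fin n) : Module.End ℂ (LogSeries n) where
  toFun φ α := MvPolynomial.pderiv j (φ (α + Pi.single j 1)) + (α j + 1) • φ (α + Pi.single j 1)
  map_add' φ ψ := by
    funext α
    simp only [Pi.add_apply, map_add, smul_add]
    abel
  map_smul' c φ := by
    funext α
    simp only [Pi.smul_apply, Derivation.map_smul, RingHom.id_apply, smul_add]
    rw [smul_comm c]

/-- The operators `x_j`, `∂_j` on logarithmic series satisfy the Weyl relations. -/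
theorem weylRel_action {n : ℕ} ⦃a b : FreeAlgebra ℂ (Fin n ⊕ Fin n)⦄ (h : WeylRel n a b) :
    FreeAlgebra.lift ℂ (Sum.elim mulX derivX : Fin n ⊕ Fin n → Module.End ℂ (LogSeries n)) a =
      FreeAlgebra.lift ℂ (Sum.elim mulX derivX) b := by
  cases h with
  | xx i j =>
    simp only [map_mul, FreeAlgebra.lift_ι_apply, Sum.elim_inl]
    apply LinearMap.ext
    intro φ
    funext α
    change φ (α - Pi.single i 1 - Pi.single j 1) = φ (α - Pi.single j 1 - Pi.single i 1)
    rw [sub_right_comm]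
  | dd i j =>
    simp only [map_mul, FreeAlgebra.lift_ι_apply, Sum.elim_inr]
    apply LinearMap.ext
    intro φ
    funext α
    rcases eq_or_ne i j with rfl | hij
    · rfl
    simp only [Module.End.mul_apply, derivX, LinearMap.coe_mk, AddHom.coe_mk]
    rw [add_right_comm α (Pi.single j 1) (Pi.single i 1)]
    generalize φ (α + Pi.single i 1 + Pi.single j 1) = p
    have hcomm : MvPolynomial.pderiv i (MvPolynomial.pderiv j p) =
        MvPolynomial.pderiv j (MvPolynomial.pderiv i p) := by
      ext m
      simp only [MvPolynomial.coeff_pderiv, Finsupp.add_apply, Finsupp.single_apply, hij,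
        hij.symm, if_false, add_zero, add_right_comm m (Finsupp.single i 1)]
      ring
    simp only [map_add, Derivation.map_smul, hcomm, Pi.add_apply, Pi.single_eq_of_ne hij,
      Pi.single_eq_of_ne hij.symm, add_zero, smul_add, smul_smul,
      mul_comm (α i + 1) (α j + 1)]
    abel
  | dx i j =>
    have hone : FreeAlgebra.lift ℂ
        (Sum.elim mulX derivX : Fin n ⊕ Fin n → Module.End ℂ (LogSeries n))
        (if i = j then 1 else 0) = if i = j then 1 else 0 := by
      split_ifs <;> simp
    simp only [map_mul, map_add, hone, FreeAlgebra.lift_ι_apply, Sum.elim_inr, Sum.elim_inl]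
    apply LinearMap.ext
    intro φ
    funext α
    simp only [Module.End.mul_apply, derivX, mulX, LinearMap.coe_mk, AddHom.coe_mk,
      LinearMap.add_apply, Pi.add_apply, Pi.sub_apply]
    rw [sub_add_eq_add_sub α (Pi.single j 1) (Pi.single i 1)]
    rcases eq_or_ne i j with rfl | hij
    · simp only [add_sub_cancel_right, Pi.single_eq_same, if_true, Module.End.one_apply,
        sub_add_cancel, add_smul, one_smul]
      abel
    · simp [hij]

/-- The action of the Weyl algebra on formal logarithmic series. -/
def weylAction (n : ℕ) : Weyl n →ₐ[ℂ] Module.End ℂ (LogSeries n) :=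
  RingQuot.liftAlgHom ℂ ⟨FreeAlgebra.lift ℂ (Sum.elim mulX derivX), weylRel_action⟩

/-- `φ` is an `A`-hypergeometric series with parameter `β`: it is annihilated by `H_A(β)`. -/
def IsHypergeometric {d n : ℕ} (A : Matrix (Fin d) (Fin n) ℤ) (β : Fin d → ℂ)
    (φ : LogSeries n) : Prop :=
  ∀ D ∈ hypIdeal A β, weylAction n D φ = 0

/-! ### The perturbed series -/

/-- `[c + t]_m = ∏_j (c_j + t_j) (c_j + t_j - 1) ⋯ (c_j + t_j - m_j + 1)`, as an element of
`ℂ[[t]]`. -/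
def falling {n : ℕ} (c : Fin n → ℂ) (m : Fin n → ℕ) : MvPowerSeries (Fin n) ℂ :=
  ∏ j, ∏ k ∈ Finset.range (m j), (MvPowerSeries.X j + MvPowerSeries.C (c j - (k : ℂ)))

theorem falling_ne_zero {n : ℕ} (c : Fin n → ℂ) (m : Fin n → ℕ) : falling c m ≠ 0 := by
  refine Finset.prod_ne_zero_iff.mpr fun j _ => Finset.prod_ne_zero_iff.mpr fun k _ h => ?_
  have h1 := congrArg (MvPowerSeries.coeff (Finsupp.single j 1)) h
  rw [map_add, MvPowerSeries.coeff_X, MvPowerSeries.coeff_C, if_pos rfl,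
    if_neg (Finsupp.single_ne_zero.mpr one_ne_zero), add_zero, map_zero] at h1
  exact one_ne_zero h1

/-- If `K ⊆ nsupp (v + u)`, then `t^{nsupp v ∖ K} a_u(t)`, where
`a_u(t) = [v + t]_{u₋} / [v + t + u]_{u₊}`, is a well-defined power series in `t`. -/
theorem existsUnique_coeff {n : ℕ} (K : Finset (Fin n)) (v : Fin n → ℂ) (u : Fin n → ℤ)
    (hK : K ⊆ nsupp (shift v u)) :
    ∃! g : MvPowerSeries (Fin n) ℂ,
      falling (shift v u) (uPlus u) * g = tpow (nsupp v \ K) * falling v (uMinus u) := by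
  classical
  have hdvd : falling (shift v u) (uPlus u) ∣ tpow (nsupp v \ K) := by
    have ht : tpow (nsupp v \ K) =
        ∏ j, if j ∈ nsupp v \ K then (MvPowerSeries.X j : MvPowerSeries (Fin n) ℂ) else 1 := by
      rw [tpow, Finset.prod_ite_mem, Finset.univ_inter]
    rw [ht]
    refine Finset.prod_dvd_prod_of_dvd _ _ fun j _ => ?_
    have hunit : ∀ k : ℕ, shift v u j - (k : ℂ) ≠ 0 → IsUnit
        (MvPowerSeries.X j + MvPowerSeries.C (shift v u j - (k : ℂ)) :
          MvPowerSeries (Fin n) ℂ) := by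
      intro k hk
      rw [MvPowerSeries.isUnit_iff_constantCoeff]
      simpa using hk
    by_cases hex : ∃ k ∈ Finset.range (uPlus u j), shift v u j - (k : ℂ) = 0
    · obtain ⟨k, hk, hk0⟩ := hex
      have hval : shift v u j = (k : ℂ) := sub_eq_zero.mp hk0
      have hk' : k < (u j).toNat := Finset.mem_range.mp hk
      have hj : j ∈ nsupp v \ K := by
        refine Finset.mem_sdiff.mpr ⟨?_, fun hjK => ?_⟩
        · refine Finset.mem_filter.mpr ⟨Finset.mem_univ _, (k : ℤ) - u j, by omega, ?_⟩
          push_cast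
          rw [← hval, shift]
          ring
        · obtain ⟨l, hl, hl'⟩ := (Finset.mem_filter.mp (hK hjK)).2
          rw [hval] at hl'
          have : (k : ℤ) = l := by exact_mod_cast hl'
          omega
      rw [if_pos hj, ← Finset.mul_prod_erase _ _ hk, hk0, map_zero, add_zero]
      refine (IsUnit.mul_right_dvd (IsUnit.prod_iff.mpr fun l hl => hunit l fun h0 => ?_)).mpr
        dvd_rfl
      refine (Finset.mem_erase.mp hl).1 ?_
      have hlk : (l : ℂ) = (k : ℂ) := by rw [← hval, sub_eq_zero.mp h0]
      exact_mod_cast hlk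
    · push Not at hex
      refine IsUnit.dvd ?_
      exact (IsUnit.prod_iff).mpr fun k hk => hunit k (hex k hk)
  obtain ⟨g, hg⟩ := hdvd
  refine ⟨g * falling v (uMinus u), ?_, fun g' hg' => ?_⟩
  · change _ * (g * _) = _
    rw [← mul_assoc, ← hg]
  · apply mul_left_cancel₀ (falling_ne_zero (shift v u) (uPlus u))
    rw [hg', hg, mul_assoc]

open Classical in
/-- The power series `t^{nsupp v ∖ K} a_u(t)`, where
`a_u(t) = [v + t]_{u₋} / [v + t + u]_{u₊}`. It is used only for `K ⊆ nsupp (v + u)`, where it is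
well-defined by `existsUnique_coeff`. -/
def pertCoeff {n : ℕ} (K : Finset (Fin n)) (v : Fin n → ℂ) (u : Fin n → ℤ) :
    MvPowerSeries (Fin n) ℂ :=
  if h : K ⊆ nsupp (shift v u) then (existsUnique_coeff K v u h).choose else 0

/-- `x^t = exp (∑_j t_j log x_j) = ∑_m y^m t^m / m!` with `y = log x`, a power series in `t`
over `ℂ[y]`. -/
def xpow (n : ℕ) : MvPowerSeries (Fin n) (MvPolynomial (Fin n) ℂ) :=
  fun m => MvPolynomial.monomial m (∏ j, ((m j).factorial : ℂ))⁻¹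

open Classical in
/-- The series `F̃_{v,𝒩'}(x, t) = t^{I₀ ∖ K} ∑_{u ∈ L, I_u ∈ 𝒩'} a_u(t) x^{v + t + u}`, where
`I_u = nsupp (v + u)`. Its value at `α` is the coefficient of `x^α`, a power series in `t` over
`ℂ[y]` with `y = log x`. -/
def pertSeries {d n : ℕ} (A : Matrix (Fin d) (Fin n) ℤ) (v : Fin n → ℂ)
    (N' : Set (Finset (Fin n))) (α : Fin n → ℂ) :
    MvPowerSeries (Fin n) (MvPolynomial (Fin n) ℂ) :=
  if h : ∃ u ∈ lattice A, α = shift v u ∧ nsupp (shift v u) ∈ N' then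
    MvPowerSeries.map MvPolynomial.C (pertCoeff (commonPart N') v h.choose) * xpow n
  else 0

/-- The logarithmic series `(q(∂_t) • F̃_{v,𝒩'}(x, t))|_{t = 0}`. -/
def frobSeries {d n : ℕ} (A : Matrix (Fin d) (Fin n) ℤ) (v : Fin n → ℂ)
    (N' : Set (Finset (Fin n))) (q : MvPolynomial (Fin n) ℂ) : LogSeries n :=
  fun α => evalDiff q (pertSeries A v N' α)

end AHyp

end

/-!
Write `g_α(t) ∈ ℂ[[t]]` for the coefficient of `x^{α + t}` in the perturbed series. Everything rests
on viewing `q ∈ ℂ[∂_t]` as the functional `p ↦ (q(∂_t) • p)|_{t = 0}` on `ℂ[[t]]`. Expanding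
`x^t = ∑_l y^l t^l / l!`, the coefficient of `y^l` in `(q(∂_t) • g(t) x^t)|_{t = 0}` is the value of
this functional on `g(t) t^l / l!` (`coeff_logPoly`). Hence this polynomial vanishes as soon as `g`
lies in an ideal to which `q` is orthogonal (`logPoly_eq_zero`), and `∂_{x_j}` acts on the functions
`α ↦ g_α` by the factors `t_j + α_j + 1` and a shift (`derivX_logSeries`). It remains to see what
the generators of `H_A(β)` do to the `g_α`.

* The Euler operators multiply `g_α`, `α ∈ v + L`, by `(At)_i`. If `α = v + u` with `I_u ∈ 𝒩'`, then
  `g_α` is divisible by `t^{I_u ∖ K}` (`tpow_dvd_pertCoeff`), so the result lies in the Euler part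
  of `Q`; otherwise `g_α = 0`.
* For `Aa = Ab` the operator `∂^a - ∂^b` pairs the exponents `v + u` and `v + u'` with
  `u - a = u' - b`. If both negative supports are in `𝒩'`, the two contributions cancel
  (`falling_mul_pertCoeff_eq`). If only `I_u` is, the remaining contribution is divisible by
  `t^{(I_u ∪ I_{u'}) ∖ K}` (`tpow_union_dvd_falling_mul_pertCoeff`), so it lies in `P`.

If `I₀ ∈ 𝒩'`, the series `g_v` is the monomial `p = t^{I₀ ∖ K}`, and the passage from `q` to the
coefficient of `x^v` is the adjoint of multiplication by `p` (`evalDiff_logPoly`). Its image on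
`Q^⊥` is contained in `(Q : p)^⊥`. Conversely, a functional `r` orthogonal to `Q : p` has to be
factored through multiplication by `p` into `ℂ[[t]]` modulo `Q` and all series of large order.
Because `Q` and `p` are homogeneous, if `p f` is congruent to an element of `Q` up to large order,
the components of `f` of degree at most `deg r` lie in `Q : p`, so `r` vanishes on `f`; this gives
the required factorization (`setOf_logPoly_eq_perp_colon`) without any finiteness of `ℂ[[t]] / Q`.
-/

noncomputable section

namespace AHyp

/-! ### The pairing between polynomials and power series -/

theorem coeff_pderiv_pow {n : ℕ} {R : Type*} [CommRing R] (j : Fin n) (a : ℕ) (k : Fin n →₀ ℕ)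
    (hk : k j = 0) (p : MvPowerSeries (Fin n) R) :
    MvPowerSeries.coeff k
        ((((MvPowerSeries.pderiv R j).toLinearMap : Module.End R (MvPowerSeries (Fin n) R)) ^ a) p) =
      (a.factorial : R) * MvPowerSeries.coeff (k + Finsupp.single j a) p := by
  induction a generalizing p with
  | zero => simp
  | succ a ih =>
    rw [pow_succ, Module.End.mul_apply, ih]
    change _ * MvPowerSeries.coeff _ (MvPowerSeries.pderiv R j p) = _
    rw [MvPowerSeries.coeff_pderiv, add_assoc, ← Finsupp.single_add, Nat.factorial_succ]
    simp only [Finsupp.add_apply, hk, Finsupp.single_eq_same, Nat.cast_mul, Nat.cast_add,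
      Nat.cast_one, zero_add]
    ring

theorem coeff_list_prod_pderiv {n : ℕ} {R : Type*} [CommRing R] (m : Fin n →₀ ℕ)
    (l : List (Fin n)) (hl : l.Nodup) (k : Fin n →₀ ℕ) (hk : ∀ j ∈ l, k j = 0)
    (p : MvPowerSeries (Fin n) R) :
    MvPowerSeries.coeff k ((l.map fun j =>
        ((MvPowerSeries.pderiv R j).toLinearMap : Module.End R (MvPowerSeries (Fin n) R))
          ^ m j).prod p) =
      (l.map fun j => ((m j).factorial : R)).prod *
        MvPowerSeries.coeff (k + (l.map fun j => Finsupp.single j (m j)).sum) p := by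
  induction l generalizing k with
  | nil => simp
  | cons j l ih =>
    obtain ⟨hj, hl⟩ := List.nodup_cons.mp hl
    rw [List.map_cons, List.prod_cons, Module.End.mul_apply,
      coeff_pderiv_pow j _ k (hk j List.mem_cons_self), ih hl]
    · simp only [List.map_cons, List.prod_cons, List.sum_cons]
      rw [mul_assoc, add_assoc]
    · intro i hi
      have hij : i ≠ j := fun h => hj (h ▸ hi)
      simp [hk i (List.mem_cons_of_mem _ hi), hij]

theorem constantCoeff_monoDiff {n : ℕ} {R : Type*} [CommRing R] (m : Fin n →₀ ℕ)
    (p : MvPowerSeries (Fin n) R) :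
    MvPowerSeries.constantCoeff (monoDiff R m p) =
      (∏ j, ((m j).factorial : R)) * MvPowerSeries.coeff m p := by
  rw [monoDiff, List.ofFn_eq_map, ← MvPowerSeries.coeff_zero_eq_constantCoeff_apply,
    coeff_list_prod_pderiv m _ (List.nodup_finRange n) 0 (fun _ _ => rfl), zero_add,
    ← List.ofFn_eq_map, List.prod_ofFn, ← List.ofFn_eq_map, List.sum_ofFn]
  rw [Finsupp.univ_sum_single m]

theorem evalDiff_eq {n : ℕ} {R : Type*} [CommRing R] [Algebra ℂ R]
    (q : MvPolynomial (Fin n) ℂ) (p : MvPowerSeries (Fin n) R) :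
    evalDiff q p = ∑ m ∈ q.support, q.coeff m •
      ((∏ j, ((m j).factorial : R)) * MvPowerSeries.coeff m p) := by
  rw [evalDiff, applyDiff, map_sum]
  refine Finset.sum_congr rfl fun m _ => ?_
  rw [← constantCoeff_monoDiff]
  rfl

/-- The functional `p ↦ (q(∂_t) • p)|_{t = 0}` on power series over `R`. -/
def evalDiffLin {n : ℕ} (R : Type*) [CommRing R] [Algebra ℂ R] (q : MvPolynomial (Fin n) ℂ) :
    MvPowerSeries (Fin n) R →ₗ[ℂ] R where
  toFun := evalDiff q
  map_add' x y := by simp [evalDiff_eq, mul_add, Finset.sum_add_distrib]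
  map_smul' c x := by
    have h : ∀ m, MvPowerSeries.coeff m (c • x) = c • MvPowerSeries.coeff m x := fun m => rfl
    simp only [evalDiff_eq, h, RingHom.id_apply, Finset.smul_sum, mul_smul_comm]
    exact Finset.sum_congr rfl fun m _ => smul_comm _ _ _

theorem evalDiff_add {n : ℕ} {R : Type*} [CommRing R] [Algebra ℂ R]
    (q : MvPolynomial (Fin n) ℂ) (x y : MvPowerSeries (Fin n) R) :
    evalDiff q (x + y) = evalDiff q x + evalDiff q y := (evalDiffLin R q).map_add x y

theorem evalDiff_smul {n : ℕ} {R : Type*} [CommRing R] [Algebra ℂ R]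
    (q : MvPolynomial (Fin n) ℂ) (c : ℂ) (x : MvPowerSeries (Fin n) R) :
    evalDiff q (c • x) = c • evalDiff q x := (evalDiffLin R q).map_smul c x

theorem evalDiff_zero {n : ℕ} {R : Type*} [CommRing R] [Algebra ℂ R]
    (q : MvPolynomial (Fin n) ℂ) : evalDiff q (0 : MvPowerSeries (Fin n) R) = 0 :=
  (evalDiffLin R q).map_zero

theorem prod_factorial_ne_zero {n : ℕ} (m : Fin n →₀ ℕ) :
    (∏ j, ((m j).factorial : ℂ)) ≠ 0 :=
  Finset.prod_ne_zero_iff.mpr fun _ _ => Nat.cast_ne_zero.mpr (Nat.factorial_ne_zero _)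

theorem evalDiff_monomial {n : ℕ} (q : MvPolynomial (Fin n) ℂ) (m : Fin n →₀ ℕ) (c : ℂ) :
    evalDiff q (MvPowerSeries.monomial m c) = q.coeff m * (∏ j, ((m j).factorial : ℂ)) * c := by
  classical
  rw [evalDiff_eq, Finset.sum_eq_single m]
  · rw [MvPowerSeries.coeff_monomial_same, smul_eq_mul, mul_assoc]
  · intro k _ hk
    rw [MvPowerSeries.coeff_monomial_ne hk, mul_zero, smul_zero]
  · intro hm
    rw [MvPolynomial.notMem_support_iff.mp hm, zero_smul]

theorem evalDiff_congr {n : ℕ} (q : MvPolynomial (Fin n) ℂ) {f g : MvPowerSeries (Fin n) ℂ}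
    (h : ∀ m ∈ q.support, MvPowerSeries.coeff m f = MvPowerSeries.coeff m g) :
    evalDiff q f = evalDiff q g := by
  rw [evalDiff_eq, evalDiff_eq]
  exact Finset.sum_congr rfl fun m hm => by rw [h m hm]

theorem perp_sup {n : ℕ} (P Q : Ideal (MvPowerSeries (Fin n) ℂ)) :
    perp (P ⊔ Q) = perp P ∩ perp Q := by
  ext q
  constructor
  · exact fun h => ⟨fun p hp => h p (Ideal.mem_sup_left hp),
      fun p hp => h p (Ideal.mem_sup_right hp)⟩
  · rintro ⟨h₁, h₂⟩ p hp
    obtain ⟨x, hx, y, hy, rfl⟩ := Submodule.mem_sup.mp hp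
    rw [evalDiff_add, h₁ x hx, h₂ y hy, add_zero]

/-! ### The polynomials `(q(∂_t) • g(t) x^t)|_{t = 0}` -/

/-- The polynomial in `y = log x` obtained as `(q(∂_t) • (g(t) x^t))|_{t = 0}`. -/
def logPoly {n : ℕ} (q : MvPolynomial (Fin n) ℂ) :
    MvPowerSeries (Fin n) ℂ →ₗ[ℂ] MvPolynomial (Fin n) ℂ where
  toFun g := evalDiff q (MvPowerSeries.map MvPolynomial.C g * xpow n)
  map_add' x y := by rw [map_add, add_mul, evalDiff_add]
  map_smul' c x := by
    have h : MvPowerSeries.map (MvPolynomial.C (σ := Fin n)) (c • x) =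
        c • MvPowerSeries.map MvPolynomial.C x := by
      ext m : 1
      change MvPolynomial.C (c * _) = c • MvPolynomial.C _
      rw [MvPolynomial.C_mul, MvPolynomial.C_mul']
      rfl
    rw [h, smul_mul_assoc, evalDiff_smul, RingHom.id_apply]

/-- Expanding `x^t = ∑_l y^l t^l / l!`, the coefficient of `y^l` in `logPoly q g` is the value of
`q(∂_t)` on `g(t) t^l / l!`. -/
theorem coeff_logPoly {n : ℕ} (q : MvPolynomial (Fin n) ℂ) (g : MvPowerSeries (Fin n) ℂ)
    (l : Fin n →₀ ℕ) :
    (logPoly q g).coeff l =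
      evalDiff q (g * MvPowerSeries.monomial l (∏ j, ((l j).factorial : ℂ))⁻¹) := by
  classical
  change MvPolynomial.coeff l (evalDiff q (MvPowerSeries.map MvPolynomial.C g * xpow n)) = _
  rw [evalDiff_eq, evalDiff_eq, MvPolynomial.coeff_sum]
  refine Finset.sum_congr rfl fun m _ => ?_
  have hc : (∏ j, ((m j).factorial : MvPolynomial (Fin n) ℂ)) =
      MvPolynomial.C (∏ j, ((m j).factorial : ℂ)) := by simp
  rw [MvPolynomial.coeff_smul, hc, MvPolynomial.coeff_C_mul, MvPowerSeries.coeff_mul,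
    MvPowerSeries.coeff_mul, MvPolynomial.coeff_sum]
  congr 2
  refine Finset.sum_congr rfl fun x _ => ?_
  rw [MvPowerSeries.coeff_map, MvPolynomial.coeff_C_mul, MvPowerSeries.coeff_monomial]
  congr 1
  change MvPolynomial.coeff l (MvPolynomial.monomial x.2 _) = _
  rw [MvPolynomial.coeff_monomial]
  split_ifs with h
  · rw [h]
  · rfl

theorem logPoly_eq_zero {n : ℕ} {P : Ideal (MvPowerSeries (Fin n) ℂ)}
    {q : MvPolynomial (Fin n) ℂ} (hq : q ∈ perp P) {g : MvPowerSeries (Fin n) ℂ} (hg : g ∈ P) :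
    logPoly q g = 0 := by
  ext l
  rw [coeff_logPoly, hq _ (P.mul_mem_right _ hg), MvPolynomial.coeff_zero]

theorem pderiv_logPoly {n : ℕ} (q : MvPolynomial (Fin n) ℂ) (g : MvPowerSeries (Fin n) ℂ)
    (j : Fin n) :
    MvPolynomial.pderiv j (logPoly q g) = logPoly q (MvPowerSeries.X j * g) := by
  classical
  ext l
  rw [MvPolynomial.coeff_pderiv, coeff_logPoly, coeff_logPoly, mul_comm, ← smul_eq_mul,
    ← evalDiff_smul]
  congr 1
  have hfac : (∏ i, ((((l + Finsupp.single j 1 : Fin n →₀ ℕ) i).factorial : ℕ) : ℂ)) =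
      (l j + 1) * ∏ i, ((l i).factorial : ℂ) := by
    rw [← Finset.mul_prod_erase _ _ (Finset.mem_univ j),
      ← Finset.mul_prod_erase Finset.univ (fun i => ((l i).factorial : ℂ)) (Finset.mem_univ j),
      ← mul_assoc]
    congr 1
    · simp [Nat.factorial_succ]
    · refine Finset.prod_congr rfl fun i hi => ?_
      simp [(Finset.ne_of_mem_erase hi).symm]
  have hj : ((l j : ℂ) + 1) ≠ 0 := Nat.cast_add_one_ne_zero _
  rw [MvPowerSeries.X, mul_comm (MvPowerSeries.monomial (Finsupp.single j 1) (1 : ℂ)), mul_assoc,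
    MvPowerSeries.monomial_mul_monomial, one_mul, hfac, add_comm (Finsupp.single j 1) l,
    ← mul_smul_comm, ← map_smul, smul_eq_mul, mul_inv, mul_inv_cancel_left₀ hj]

/-- The action of a factor `t_j + c` is the action of `∂_{y_j} + c` on polynomials in `log x`. -/
theorem pderiv_add_smul_logPoly {n : ℕ} (q : MvPolynomial (Fin n) ℂ)
    (g : MvPowerSeries (Fin n) ℂ) (j : Fin n) (c : ℂ) :
    MvPolynomial.pderiv j (logPoly q g) + c • logPoly q g =
      logPoly q ((MvPowerSeries.X j + MvPowerSeries.C c) * g) := by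
  rw [pderiv_logPoly, ← map_smul, ← map_add, add_mul, ← MvPowerSeries.smul_eq_C_mul]

/-! ### Duality for homogeneous ideals -/

theorem evalDiff_eq_sum_of_subset {n : ℕ} (q : MvPolynomial (Fin n) ℂ)
    (f : MvPowerSeries (Fin n) ℂ) {T : Finset (Fin n →₀ ℕ)} (hT : q.support ⊆ T) :
    evalDiff q f = ∑ m ∈ T, q.coeff m *
      ((∏ j, ((m j).factorial : ℂ)) * MvPowerSeries.coeff m f) := by
  rw [evalDiff_eq]
  refine Finset.sum_subset hT fun m _ hm => ?_
  rw [MvPolynomial.notMem_support_iff.mp hm, zero_smul]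

theorem coeff_sum_monomial {n : ℕ} (T : Finset (Fin n →₀ ℕ)) (c : (Fin n →₀ ℕ) → ℂ)
    {m : Fin n →₀ ℕ} (hm : m ∈ T) :
    MvPowerSeries.coeff m (∑ k ∈ T, MvPowerSeries.monomial k (c k)) = c m := by
  classical
  rw [map_sum, Finset.sum_eq_single m]
  · exact MvPowerSeries.coeff_monomial_same _ _
  · exact fun k _ hk => MvPowerSeries.coeff_monomial_ne hk.symm _
  · exact fun h => absurd hm h

theorem eq_of_evalDiff_eq {n : ℕ} {q r : MvPolynomial (Fin n) ℂ}
    (h : ∀ f : MvPowerSeries (Fin n) ℂ, evalDiff q f = evalDiff r f) : q = r := by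
  ext m
  have hm := h (MvPowerSeries.monomial m 1)
  rw [evalDiff_monomial, evalDiff_monomial, mul_one, mul_one] at hm
  exact mul_right_cancel₀ (prod_factorial_ne_zero m) hm

/-- `q ↦ logPoly q p` is adjoint to multiplication by `p`. -/
theorem evalDiff_logPoly {n : ℕ} (q : MvPolynomial (Fin n) ℂ) (p f : MvPowerSeries (Fin n) ℂ) :
    evalDiff (logPoly q p) f = evalDiff q (p * f) := by
  classical
  -- Only the coefficients of `f` below some exponent of `q` enter into `evalDiff q (p * f)`.
  set T := (logPoly q p).support ∪ q.support.biUnion Finset.Iic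
  have hcongr : evalDiff q (p * f) =
      evalDiff q (p * ∑ m ∈ T, MvPowerSeries.monomial m (MvPowerSeries.coeff m f)) := by
    refine evalDiff_congr q fun m hm => ?_
    rw [MvPowerSeries.coeff_mul, MvPowerSeries.coeff_mul]
    refine Finset.sum_congr rfl fun x hx => ?_
    rw [coeff_sum_monomial T (fun m => MvPowerSeries.coeff m f)]
    refine Finset.mem_union_right _ (Finset.mem_biUnion.mpr ⟨m, hm, Finset.mem_Iic.mpr ?_⟩)
    exact Finset.HasAntidiagonal.mem_antidiagonal.mp hx ▸ le_add_self
  rw [hcongr, evalDiff_eq_sum_of_subset (logPoly q p) f (Finset.subset_union_left : _ ⊆ T),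
    Finset.mul_sum]
  refine Eq.trans ?_ (map_sum (evalDiffLin ℂ q) _ _).symm
  refine Finset.sum_congr rfl fun m _ => ?_
  change _ = evalDiff q _
  rw [coeff_logPoly, mul_comm, ← smul_eq_mul, ← evalDiff_smul, ← mul_smul_comm, ← map_smul,
    smul_eq_mul, mul_right_comm, mul_inv_cancel₀ (prod_factorial_ne_zero m), one_mul]

theorem homogeneousComponent_mul {n : ℕ} {g : MvPowerSeries (Fin n) ℂ} {e : ℕ}
    (hg : g.IsHomogeneous e) (f : MvPowerSeries (Fin n) ℂ) (k : ℕ) :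
    MvPowerSeries.homogeneousComponent (k + e) (f * g) =
      MvPowerSeries.homogeneousComponent k f * g := by
  classical
  ext m
  rw [MvPowerSeries.coeff_homogeneousComponent]
  split_ifs with hm
  · rw [MvPowerSeries.coeff_mul, MvPowerSeries.coeff_mul]
    refine Finset.sum_congr rfl fun x hx => ?_
    rw [MvPowerSeries.coeff_homogeneousComponent]
    by_cases hx2 : x.2.degree = e
    · have hx' : x.1.degree + x.2.degree = k + e := by
        rw [← map_add, Finset.HasAntidiagonal.mem_antidiagonal.mp hx, hm]
      rw [if_pos (by omega)]
    · rw [hg.coeff_eq_zero hx2, mul_zero, mul_zero]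
  · exact (MvPowerSeries.IsHomogeneous.coeff_eq_zero (MvPowerSeries.IsHomogeneous.mul
      (MvPowerSeries.isHomogeneous_homogeneousComponent f k) hg) hm).symm

theorem homogeneousComponent_mul_of_lt {n : ℕ} {g : MvPowerSeries (Fin n) ℂ} {e : ℕ}
    (hg : g.IsHomogeneous e) (f : MvPowerSeries (Fin n) ℂ) {k : ℕ} (hk : k < e) :
    MvPowerSeries.homogeneousComponent k (f * g) = 0 := by
  classical
  ext m
  rw [MvPowerSeries.coeff_homogeneousComponent, map_zero]
  split_ifs with hm
  · rw [MvPowerSeries.coeff_mul]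
    refine Finset.sum_eq_zero fun x hx => ?_
    have hx' : x.1.degree + x.2.degree = k := by
      rw [← map_add, Finset.HasAntidiagonal.mem_antidiagonal.mp hx, hm]
    rw [hg.coeff_eq_zero (by omega), mul_zero]
  · rfl

theorem homogeneousComponent_mem_span {n : ℕ} {S : Set (MvPowerSeries (Fin n) ℂ)}
    (hS : ∀ g ∈ S, ∃ e, g.IsHomogeneous e) {f : MvPowerSeries (Fin n) ℂ}
    (hf : f ∈ Ideal.span S) (k : ℕ) :
    MvPowerSeries.homogeneousComponent k f ∈ Ideal.span S := by
  refine Submodule.closure_induction (p := fun f _ =>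
    MvPowerSeries.homogeneousComponent k f ∈ Ideal.span S) ?_ ?_ ?_ hf
  · rw [map_zero]
    exact zero_mem _
  · intro x y _ _ hx hy
    rw [map_add]
    exact add_mem hx hy
  · intro a g hg
    obtain ⟨e, he⟩ := hS g hg
    rw [smul_eq_mul]
    rcases lt_or_ge k e with hk | hk
    · rw [homogeneousComponent_mul_of_lt he a hk]
      exact zero_mem _
    · rw [← Nat.sub_add_cancel hk, homogeneousComponent_mul he]
      exact Ideal.mul_mem_left _ _ (Ideal.subset_span hg)

/-- The power series of order at least `N`. -/
def orderGE (n N : ℕ) : Submodule ℂ (MvPowerSeries (Fin n) ℂ) where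
  carrier := {f | ∀ m : Fin n →₀ ℕ, m.degree < N → MvPowerSeries.coeff m f = 0}
  zero_mem' := fun _ _ => map_zero _
  add_mem' := fun hf hg m hm => by rw [map_add, hf m hm, hg m hm, add_zero]
  smul_mem' := fun c f hf m hm => by
    rw [MvPowerSeries.smul_eq_C_mul, MvPowerSeries.coeff_C_mul, hf m hm, mul_zero]

/-- A linear functional vanishing on the series of large order is given by a differential
operator with constant coefficients. -/
theorem exists_evalDiff_eq {n N : ℕ} (L : MvPowerSeries (Fin n) ℂ →ₗ[ℂ] ℂ)
    (hL : ∀ f ∈ orderGE n N, L f = 0) :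
    ∃ q : MvPolynomial (Fin n) ℂ, ∀ f, evalDiff q f = L f := by
  classical
  set T : Finset (Fin n →₀ ℕ) := Finset.Iic (Finsupp.equivFunOnFinite.symm fun _ => N)
  have hmem : ∀ m : Fin n →₀ ℕ, m.degree < N → m ∈ T := fun m hm => by
    refine Finset.mem_Iic.mpr fun j => ?_
    exact (Finsupp.le_degree j m).trans hm.le
  set c : (Fin n →₀ ℕ) → ℂ := fun m =>
    L (MvPowerSeries.monomial m 1) * (∏ j, ((m j).factorial : ℂ))⁻¹ with hc
  set q : MvPolynomial (Fin n) ℂ := ∑ m ∈ T, MvPolynomial.monomial m (c m) with hq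
  have hcoeff : ∀ m, q.coeff m = if m ∈ T then c m else 0 := fun m => by
    rw [hq, MvPolynomial.coeff_sum]
    simp only [MvPolynomial.coeff_monomial]
    rw [Finset.sum_ite_eq' T m c]
  have hsupp : q.support ⊆ T := fun m hm => by
    by_contra h
    exact MvPolynomial.mem_support_iff.mp hm (by rw [hcoeff, if_neg h])
  refine ⟨q, fun f => ?_⟩
  have hf : L f = L (∑ m ∈ T, MvPowerSeries.monomial m (MvPowerSeries.coeff m f)) := by
    rw [← sub_eq_zero, ← map_sub]
    refine hL _ fun m hm => ?_
    rw [map_sub, coeff_sum_monomial T (fun m => MvPowerSeries.coeff m f) (hmem m hm), sub_self]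
  rw [hf, map_sum, evalDiff_eq_sum_of_subset q f hsupp]
  refine Finset.sum_congr rfl fun m hm => ?_
  have hmon : MvPowerSeries.monomial m (MvPowerSeries.coeff m f) =
      MvPowerSeries.coeff m f • MvPowerSeries.monomial m (1 : ℂ) := by
    rw [← map_smul, smul_eq_mul, mul_one]
  rw [hcoeff, if_pos hm, hmon, map_smul, smul_eq_mul, hc, mul_assoc,
    inv_mul_cancel_left₀ (prod_factorial_ne_zero m), mul_comm]

/-- For a homogeneous ideal `Q` and a homogeneous `p`, the operators orthogonal to the colon ideal
`Q : p` are exactly the contractions by `p` of the operators orthogonal to `Q`. A functional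
orthogonal to `Q : p` factors through multiplication by `p` modulo `Q` and series of large order,
where homogeneity keeps the truncation from enlarging the kernel. -/
theorem setOf_logPoly_eq_perp_colon {n : ℕ} {Q : Ideal (MvPowerSeries (Fin n) ℂ)}
    (hQ : ∀ f ∈ Q, ∀ k, MvPowerSeries.homogeneousComponent k f ∈ Q)
    {p : MvPowerSeries (Fin n) ℂ} {e : ℕ} (hp : p.IsHomogeneous e) :
    {r | ∃ q ∈ perp Q, r = logPoly q p} = perp (Q.colon {p}) := by
  classical
  ext r
  constructor
  · rintro ⟨q, hq, rfl⟩ f hf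
    rw [Submodule.mem_colon_singleton, smul_eq_mul] at hf
    rw [evalDiff_logPoly, mul_comm]
    exact hq _ hf
  · intro hr
    set D := r.support.sup Finsupp.degree
    set U : Submodule ℂ (MvPowerSeries (Fin n) ℂ) :=
      Q.restrictScalars ℂ ⊔ orderGE n (D + e + 1)
    set T := U.mkQ ∘ₗ LinearMap.mulLeft ℂ p
    have hker : LinearMap.ker T ≤ LinearMap.ker (evalDiffLin ℂ r) := by
      intro f hf
      have hpf : p * f ∈ U := (Submodule.Quotient.mk_eq_zero U).mp hf
      obtain ⟨z, hz, h, hh, hzh⟩ := Submodule.mem_sup.mp hpf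
      -- The components of `f` of degree at most `deg r` lie in `Q : p`.
      have hcomp : ∀ k ≤ D, MvPowerSeries.homogeneousComponent k f ∈ Q.colon {p} := by
        intro k hk
        rw [Submodule.mem_colon_singleton, smul_eq_mul, ← homogeneousComponent_mul hp,
          mul_comm f p, ← hzh, map_add]
        have hh0 : MvPowerSeries.homogeneousComponent (k + e) h = 0 := by
          ext m
          rw [MvPowerSeries.coeff_homogeneousComponent, map_zero]
          split_ifs with hm
          · exact hh m (by omega)
          · rfl
        rw [hh0, add_zero]
        exact hQ z hz _
      have hsum : evalDiff r f =
          evalDiff r (∑ k ∈ Finset.range (D + 1), MvPowerSeries.homogeneousComponent k f) := by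
        refine evalDiff_congr r fun m hm => ?_
        have hmD : m.degree ≤ D := Finset.le_sup hm
        simp only [map_sum, MvPowerSeries.coeff_homogeneousComponent]
        rw [Finset.sum_ite_eq, if_pos (Finset.mem_range.mpr (by omega))]
      change evalDiff r f = 0
      rw [hsum]
      exact hr _ (Submodule.sum_mem _ fun k hk =>
        hcomp k (Nat.lt_succ_iff.mp (Finset.mem_range.mp hk)))
    have hrange : evalDiffLin ℂ r ∈ LinearMap.range T.dualMap := by
      rw [LinearMap.range_dualMap_eq_dualAnnihilator_ker, Submodule.mem_dualAnnihilator]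
      exact fun f hf => hker hf
    obtain ⟨L, hL⟩ := hrange
    obtain ⟨q, hq⟩ := exists_evalDiff_eq (N := D + e + 1) (L ∘ₗ U.mkQ) fun f hf => by
      change L (U.mkQ f) = 0
      rw [Submodule.mkQ_apply, (Submodule.Quotient.mk_eq_zero U).mpr (Submodule.mem_sup_right hf),
        map_zero]
    refine ⟨q, fun f hf => ?_, eq_of_evalDiff_eq fun f => ?_⟩
    · rw [hq]
      change L (U.mkQ f) = 0
      rw [Submodule.mkQ_apply, (Submodule.Quotient.mk_eq_zero U).mpr (Submodule.mem_sup_left hf),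
        map_zero]
    · rw [evalDiff_logPoly, hq]
      exact (LinearMap.congr_fun hL f).symm

theorem isHomogeneous_tpow {n : ℕ} (J : Finset (Fin n)) : (tpow J).IsHomogeneous J.card := by
  classical
  induction J using Finset.induction_on with
  | empty =>
    intro m hm
    rw [tpow, Finset.prod_empty, MvPowerSeries.coeff_one] at hm
    have : m = 0 := by
      by_contra h
      exact hm (if_neg h)
    simp [this]
  | insert j J hj ih =>
    rw [tpow, Finset.prod_insert hj, Finset.card_insert_of_notMem hj, add_comm]
    refine MvPowerSeries.IsHomogeneous.mul ?_ ih
    intro m hm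
    rw [MvPowerSeries.coeff_X] at hm
    have : m = Finsupp.single j 1 := by
      by_contra h
      exact hm (if_neg h)
    rw [this, Finsupp.weight_single, Pi.one_apply, smul_eq_mul, mul_one]

theorem isHomogeneous_linForm {d n : ℕ} (A : Matrix (Fin d) (Fin n) ℤ) (i : Fin d) :
    (linForm A i).IsHomogeneous 1 := by
  classical
  intro m hm
  by_contra h
  refine hm ?_
  rw [linForm, map_sum]
  refine Finset.sum_eq_zero fun j _ => ?_
  rw [MvPowerSeries.coeff_C_mul, MvPowerSeries.coeff_X, if_neg, mul_zero]
  rintro rfl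
  exact h (by rw [Finsupp.weight_single, Pi.one_apply, smul_eq_mul, mul_one])

theorem homogeneousComponent_mem_idealQ {d n : ℕ} (A : Matrix (Fin d) (Fin n) ℤ)
    (v₀ : Fin n → ℂ) (N' : Set (Finset (Fin n))) {f : MvPowerSeries (Fin n) ℂ}
    (hf : f ∈ idealQ A v₀ N') (k : ℕ) :
    MvPowerSeries.homogeneousComponent k f ∈ idealQ A v₀ N' := by
  rw [idealQ, eulerIdeal, idealP, ← Ideal.span_union] at hf ⊢
  refine homogeneousComponent_mem_span ?_ hf k
  rintro g (⟨i, I, _, rfl⟩ | ⟨I, _, J, _, rfl⟩)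
  · exact ⟨_, MvPowerSeries.IsHomogeneous.mul (isHomogeneous_linForm A i) (isHomogeneous_tpow _)⟩
  · exact ⟨_, isHomogeneous_tpow _⟩

/-! ### Divisibility by squarefree monomials -/

theorem X_prime {σ : Type*} (j : σ) : Prime (MvPowerSeries.X j : MvPowerSeries σ ℂ) := by
  classical
  have h1 : ¬ IsUnit (MvPowerSeries.X j : MvPowerSeries σ ℂ) := by
    rw [MvPowerSeries.isUnit_iff_constantCoeff, MvPowerSeries.constantCoeff_X]
    exact not_isUnit_zero
  refine ⟨fun h0 => ?_, h1, fun f g hfg => ?_⟩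
  · have h := congrArg (MvPowerSeries.coeff (Finsupp.single j 1)) h0
    rw [MvPowerSeries.coeff_X, if_pos rfl, map_zero] at h
    exact one_ne_zero h
  · set free : MvPowerSeries σ ℂ → MvPowerSeries σ ℂ :=
      fun f m => if m j = 0 then MvPowerSeries.coeff m f else 0
    have hcoeff : ∀ f m, MvPowerSeries.coeff m (free f) =
      if m j = 0 then MvPowerSeries.coeff m f else 0 := fun _ _ => rfl
    -- This product agrees with `f * g` modulo the variable, which does not occur in it.
    have hzero : free f * free g = 0 := by
      ext m
      rw [map_zero]
      by_cases hm : m j = 0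
      · rw [← MvPowerSeries.X_dvd_iff.mp hfg m hm, MvPowerSeries.coeff_mul, MvPowerSeries.coeff_mul]
        refine Finset.sum_congr rfl fun x hx => ?_
        have hx' : x.1 j + x.2 j = 0 := by
          rw [← Finsupp.add_apply, Finset.HasAntidiagonal.mem_antidiagonal.mp hx, hm]
        rw [hcoeff, hcoeff, if_pos (by omega), if_pos (by omega)]
      · rw [MvPowerSeries.coeff_mul]
        refine Finset.sum_eq_zero fun x hx => ?_
        have hx' : x.1 j + x.2 j ≠ 0 := by
          rwa [← Finsupp.add_apply, Finset.HasAntidiagonal.mem_antidiagonal.mp hx]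
        rw [hcoeff, hcoeff]
        by_cases h : x.1 j = 0
        · rw [if_neg (show ¬ x.2 j = 0 by omega), mul_zero]
        · rw [if_neg h, zero_mul]
    have hdvd : ∀ f, free f = 0 → MvPowerSeries.X j ∣ f := fun f hf => by
      refine MvPowerSeries.X_dvd_iff.mpr fun m hm => ?_
      have h := hcoeff f m
      rwa [hf, map_zero, if_pos hm, eq_comm] at h
    exact (mul_eq_zero.mp hzero).imp (hdvd f) (hdvd g)

theorem X_dvd_X_add_C {n : ℕ} {i j : Fin n} {c : ℂ}
    (h : (MvPowerSeries.X j : MvPowerSeries (Fin n) ℂ) ∣ MvPowerSeries.X i + MvPowerSeries.C c) :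
    i = j ∧ c = 0 := by
  classical
  rw [MvPowerSeries.X_dvd_iff] at h
  constructor
  · by_contra hij
    have h1 := h (Finsupp.single i 1) (by simp [hij])
    rw [map_add, MvPowerSeries.coeff_X, if_pos rfl, MvPowerSeries.coeff_C,
      if_neg (Finsupp.single_ne_zero.mpr one_ne_zero), add_zero] at h1
    exact one_ne_zero h1
  · have h0 := h 0 rfl
    simpa using h0

theorem tpow_dvd {n : ℕ} {J : Finset (Fin n)} {f : MvPowerSeries (Fin n) ℂ}
    (h : ∀ j ∈ J, MvPowerSeries.X j ∣ f) : tpow J ∣ f := by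
  classical
  induction J using Finset.induction_on with
  | empty => exact one_dvd _
  | insert j J hj ih =>
    obtain ⟨g, rfl⟩ := ih fun i hi => h i (Finset.mem_insert_of_mem hi)
    have hdvd := ((X_prime j).dvd_or_dvd (h j (Finset.mem_insert_self j J))).resolve_left
        fun hJ => by
      obtain ⟨i, hi, hij⟩ := (X_prime j).exists_mem_finset_dvd hJ
      have := X_dvd_X_add_C (i := i) (j := j) (c := 0) (by rwa [map_zero, add_zero])
      exact hj (this.1 ▸ hi)
    rw [tpow, Finset.prod_insert hj, mul_comm]
    exact mul_dvd_mul_left _ hdvd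

theorem X_dvd_tpow {n : ℕ} {J : Finset (Fin n)} {j : Fin n} (hj : j ∈ J) :
    MvPowerSeries.X j ∣ tpow J := Finset.dvd_prod_of_mem _ hj

theorem X_dvd_falling_iff {n : ℕ} (c : Fin n → ℂ) (m : Fin n → ℕ) (j : Fin n) :
    MvPowerSeries.X j ∣ falling c m ↔ ∃ k < m j, c j = (k : ℂ) := by
  constructor
  · intro h
    obtain ⟨i, _, hi⟩ := (X_prime j).exists_mem_finset_dvd h
    obtain ⟨k, hk, hik⟩ := (X_prime j).exists_mem_finset_dvd hi
    obtain ⟨rfl, h0⟩ := X_dvd_X_add_C hik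
    exact ⟨k, Finset.mem_range.mp hk, sub_eq_zero.mp h0⟩
  · rintro ⟨k, hk, h0⟩
    refine dvd_trans ?_ (Finset.dvd_prod_of_mem _ (Finset.mem_univ j))
    refine dvd_trans ?_ (Finset.dvd_prod_of_mem _ (Finset.mem_range.mpr hk))
    rw [h0, sub_self, map_zero, add_zero]

/-! ### Quotients of falling factorials -/

theorem mem_nsupp {n : ℕ} {v : Fin n → ℂ} {j : Fin n} :
    j ∈ nsupp v ↔ ∃ k : ℤ, k < 0 ∧ v j = (k : ℂ) := by simp [nsupp]

theorem shift_shift {n : ℕ} (v : Fin n → ℂ) (u u' : Fin n → ℤ) :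
    shift (shift v u) u' = shift v (u + u') := by
  funext j
  simp only [shift, Pi.add_apply, Int.cast_add]
  ring

theorem shift_zero {n : ℕ} (v : Fin n → ℂ) : shift v 0 = v := by
  funext j
  simp [shift]

theorem shift_injective {n : ℕ} (v : Fin n → ℂ) : Function.Injective (shift v) := by
  intro u u' h
  funext j
  have := congrFun h j
  simpa [shift] using this

theorem falling_add {n : ℕ} (c : Fin n → ℂ) (m k : Fin n → ℕ) :
    falling c (m + k) = falling c m * falling (shift c fun j => -(m j : ℤ)) k := by
  rw [falling, falling, falling, ← Finset.prod_mul_distrib]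
  refine Finset.prod_congr rfl fun j _ => ?_
  rw [Pi.add_apply, Finset.prod_range_add]
  congr 1
  refine Finset.prod_congr rfl fun k _ => ?_
  simp only [shift]
  congr 2
  push_cast
  ring

theorem falling_mul_pertCoeff {n : ℕ} {K : Finset (Fin n)} {v : Fin n → ℂ} {u : Fin n → ℤ}
    (hK : K ⊆ nsupp (shift v u)) :
    falling (shift v u) (uPlus u) * pertCoeff K v u = tpow (nsupp v \ K) * falling v (uMinus u) := by
  rw [pertCoeff, dif_pos hK]
  exact (existsUnique_coeff K v u hK).choose_spec.1

theorem pertCoeff_zero {n : ℕ} {K : Finset (Fin n)} {v : Fin n → ℂ} (hK : K ⊆ nsupp v) :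
    pertCoeff K v 0 = tpow (nsupp v \ K) := by
  have h := falling_mul_pertCoeff (K := K) (v := v) (u := 0) (by rwa [shift_zero])
  simpa [falling, uPlus, uMinus] using h

/-- The defining relation of `pertCoeff`, with both products of factors continued down to the common
base point `v - N`. -/
theorem falling_add_mul_pertCoeff {n : ℕ} {K : Finset (Fin n)} {v : Fin n → ℂ} {u : Fin n → ℤ}
    (hK : K ⊆ nsupp (shift v u)) (N M : Fin n → ℕ) (hM : ∀ j, (M j : ℤ) = u j + N j) :
    falling (shift v u) M * pertCoeff K v u = tpow (nsupp v \ K) * falling v N := by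
  set r : Fin n → ℕ := fun j => N j - uMinus u j with hr
  have hM' : M = uPlus u + r := by
    funext j
    have := hM j
    simp only [hr, uPlus, uMinus, Pi.add_apply]
    omega
  have hN' : N = uMinus u + r := by
    funext j
    have := hM j
    simp only [hr, uMinus, Pi.add_apply]
    omega
  have hbase : (shift (shift v u) fun j => -(uPlus u j : ℤ)) =
      shift v fun j => -(uMinus u j : ℤ) := by
    rw [shift_shift]
    congr 1
    funext j
    simp only [uPlus, uMinus, Pi.add_apply]
    omega
  rw [hM', hN', falling_add, falling_add, hbase, mul_right_comm, falling_mul_pertCoeff hK,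
    mul_assoc]

/-- Differentiating the terms with exponents `v + u` and `v + u'` down to the same exponent gives
the same coefficient. -/
theorem falling_mul_pertCoeff_eq {n : ℕ} {K : Finset (Fin n)} {v : Fin n → ℂ} {u u' : Fin n → ℤ}
    (hK : K ⊆ nsupp (shift v u)) (hK' : K ⊆ nsupp (shift v u')) (a b : Fin n → ℕ)
    (hab : ∀ j, u j - a j = u' j - b j) :
    falling (shift v u) a * pertCoeff K v u = falling (shift v u') b * pertCoeff K v u' := by
  -- Both sides satisfy the relation defining the quotient for `z = u - a = u' - b`.
  set N : Fin n → ℕ := fun j => (a j - u j).toNat with hN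
  set Z : Fin n → ℕ := fun j => (u j - a j + N j).toNat with hZ
  set z : Fin n → ℤ := fun j => u j - a j with hz
  have h1 : falling (shift v z) Z * (falling (shift v u) a * pertCoeff K v u) =
      tpow (nsupp v \ K) * falling v N := by
    rw [← falling_add_mul_pertCoeff hK N (a + Z) fun j => ?_, falling_add, shift_shift]
    · have : (u + fun j => -(a j : ℤ)) = z := funext fun j => by simp [hz, sub_eq_add_neg]
      rw [this]
      ring
    · simp only [hZ, hN, Pi.add_apply]
      omega
  have h2 : falling (shift v z) Z * (falling (shift v u') b * pertCoeff K v u') =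
      tpow (nsupp v \ K) * falling v N := by
    rw [← falling_add_mul_pertCoeff hK' N (b + Z) fun j => ?_, falling_add, shift_shift]
    · have : (u' + fun j => -(b j : ℤ)) = z :=
        funext fun j => by rw [Pi.add_apply, ← sub_eq_add_neg, ← hab j]
      rw [this]
      ring
    · have := hab j
      simp only [hZ, hN, Pi.add_apply]
      omega
  exact mul_left_cancel₀ (falling_ne_zero _ _) (h1.trans h2.symm)

theorem tpow_dvd_pertCoeff {n : ℕ} {K : Finset (Fin n)} {v : Fin n → ℂ} {u : Fin n → ℤ}
    (hK : K ⊆ nsupp (shift v u)) : tpow (nsupp (shift v u) \ K) ∣ pertCoeff K v u := by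
  refine tpow_dvd fun j hj => ?_
  obtain ⟨hju, hjK⟩ := Finset.mem_sdiff.mp hj
  obtain ⟨k, hk, hk'⟩ := mem_nsupp.mp hju
  -- The denominator is not divisible by `t_j`, so the factor `t_j` is seen in the numerator.
  have hdvd : MvPowerSeries.X j ∣ falling (shift v u) (uPlus u) * pertCoeff K v u := by
    rw [falling_mul_pertCoeff hK]
    have hv : v j = ((k - u j : ℤ) : ℂ) := by
      rw [Int.cast_sub, ← hk', shift]
      ring
    rcases lt_or_ge (k - u j) 0 with h | h
    · exact (X_dvd_tpow (Finset.mem_sdiff.mpr ⟨mem_nsupp.mpr ⟨_, h, hv⟩, hjK⟩)).mul_right _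
    · refine Dvd.dvd.mul_left ((X_dvd_falling_iff _ _ _).mpr ⟨(k - u j).toNat, ?_, ?_⟩) _
      · simp only [uMinus]
        omega
      · rw [hv]
        exact_mod_cast (Int.toNat_of_nonneg h).symm
  refine ((X_prime j).dvd_or_dvd hdvd).resolve_left fun h => ?_
  obtain ⟨l, _, hl⟩ := (X_dvd_falling_iff _ _ _).mp h
  rw [hk'] at hl
  have : k = (l : ℤ) := by exact_mod_cast hl
  omega

theorem tpow_union_dvd_falling_mul_pertCoeff {n : ℕ} {K J : Finset (Fin n)} {v : Fin n → ℂ}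
    {u : Fin n → ℤ} (hK : K ⊆ nsupp (shift v u)) (a : Fin n → ℕ)
    (hJ : J ⊆ nsupp (shift v fun j => u j - a j)) :
    tpow ((nsupp (shift v u) ∪ J) \ K) ∣ falling (shift v u) a * pertCoeff K v u := by
  refine tpow_dvd fun j hj => ?_
  obtain ⟨hj, hjK⟩ := Finset.mem_sdiff.mp hj
  by_cases hju : j ∈ nsupp (shift v u)
  · exact ((X_dvd_tpow (Finset.mem_sdiff.mpr ⟨hju, hjK⟩)).trans (tpow_dvd_pertCoeff hK)).mul_left _
  · obtain ⟨k, hk, hk'⟩ := mem_nsupp.mp (hJ ((Finset.mem_union.mp hj).resolve_left hju))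
    have hval : shift v u j = ((k + a j : ℤ) : ℂ) := by
      rw [Int.cast_add, ← hk']
      simp only [shift, Int.cast_sub, Int.cast_natCast]
      ring
    have hnn : 0 ≤ k + a j := by
      by_contra h
      exact hju (mem_nsupp.mpr ⟨_, not_le.mp h, hval⟩)
    refine Dvd.dvd.mul_right ((X_dvd_falling_iff _ _ _).mpr ⟨(k + a j).toNat, by omega, ?_⟩) _
    rw [hval]
    exact_mod_cast (Int.toNat_of_nonneg hnn).symm

/-! ### The Weyl algebra acting on series with power series coefficients -/

/-- The logarithmic series `(q(∂_t) • ∑_α g_α(t) x^{α + t})|_{t = 0}`. -/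
def logSeries {n : ℕ} (q : MvPolynomial (Fin n) ℂ)
    (g : (Fin n → ℂ) → MvPowerSeries (Fin n) ℂ) : LogSeries n :=
  fun α => logPoly q (g α)

theorem weylAction_wx {n : ℕ} (j : Fin n) : weylAction n (wx j) = mulX j := by
  rw [weylAction, wx, RingQuot.liftAlgHom_mkAlgHom_apply, FreeAlgebra.lift_ι_apply, Sum.elim_inl]

theorem weylAction_wd {n : ℕ} (j : Fin n) : weylAction n (wd j) = derivX j := by
  rw [weylAction, wd, RingQuot.liftAlgHom_mkAlgHom_apply, FreeAlgebra.lift_ι_apply, Sum.elim_inr]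

theorem derivX_logSeries {n : ℕ} (q : MvPolynomial (Fin n) ℂ)
    (g : (Fin n → ℂ) → MvPowerSeries (Fin n) ℂ) (j : Fin n) :
    derivX j (logSeries q g) = logSeries q fun α =>
      (MvPowerSeries.X j + MvPowerSeries.C (α j + 1)) * g (α + Pi.single j 1) :=
  funext fun α => pderiv_add_smul_logPoly q (g (α + Pi.single j 1)) j (α j + 1)

theorem derivX_pow_logSeries {n : ℕ} (q : MvPolynomial (Fin n) ℂ)
    (g : (Fin n → ℂ) → MvPowerSeries (Fin n) ℂ) (j : Fin n) (a : ℕ) :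
    (derivX j ^ a) (logSeries q g) = logSeries q fun α =>
      (∏ k ∈ Finset.range a, (MvPowerSeries.X j + MvPowerSeries.C (α j + a - k))) *
        g (α + Pi.single j (a : ℂ)) := by
  induction a with
  | zero => simp
  | succ a ih =>
    rw [pow_succ', Module.End.mul_apply, ih, derivX_logSeries]
    congr 1
    funext α
    have hs : α + Pi.single j (1 : ℂ) + Pi.single j (a : ℂ) = α + Pi.single j ((a + 1 : ℕ) : ℂ) := by
      rw [add_assoc, ← Pi.single_add, Nat.cast_succ, add_comm (1 : ℂ)]
    rw [hs, ← mul_assoc, Finset.prod_range_succ, mul_comm (MvPowerSeries.X j + _)]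
    congr 2
    · refine Finset.prod_congr rfl fun k _ => ?_
      rw [Pi.add_apply, Pi.single_eq_same, Nat.cast_succ]
      congr 2
      ring
    · rw [Nat.cast_succ]
      congr 2
      ring

theorem list_prod_derivX_logSeries {n : ℕ} (q : MvPolynomial (Fin n) ℂ)
    (g : (Fin n → ℂ) → MvPowerSeries (Fin n) ℂ) (m : Fin n →₀ ℕ) (l : List (Fin n))
    (hl : l.Nodup) :
    (l.map fun j => derivX j ^ m j).prod (logSeries q g) = logSeries q fun α =>
      (l.map fun j => ∏ k ∈ Finset.range (m j),
        (MvPowerSeries.X j + MvPowerSeries.C (α j + m j - k))).prod *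
      g (α + (l.map fun j => Pi.single j (m j : ℂ)).sum) := by
  induction l with
  | nil => simp
  | cons j l ih =>
    obtain ⟨hj, hl⟩ := List.nodup_cons.mp hl
    rw [List.map_cons, List.prod_cons, Module.End.mul_apply, ih hl, derivX_pow_logSeries]
    congr 1
    funext α
    rw [List.map_cons, List.prod_cons, List.map_cons, List.sum_cons, mul_assoc, add_assoc]
    congr 3
    refine List.map_congr_left fun i hi => ?_
    have hij : i ≠ j := fun h => hj (h ▸ hi)
    rw [Pi.add_apply, Pi.single_eq_of_ne hij, add_zero]

/-- The coefficient of `x^{α + t}` in `p(∂_x) • ∑_α g_α(t) x^{α + t}`, as a linear function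
of `p`. -/
def polyDCoeff {n : ℕ} (g : (Fin n → ℂ) → MvPowerSeries (Fin n) ℂ) (α : Fin n → ℂ) :
    MvPolynomial (Fin n) ℂ →ₗ[ℂ] MvPowerSeries (Fin n) ℂ :=
  (MvPolynomial.basisMonomials (Fin n) ℂ).constr ℂ fun m =>
    falling (shift α fun j => m j) m * g (shift α fun j => m j)

theorem polyDCoeff_monomial {n : ℕ} (g : (Fin n → ℂ) → MvPowerSeries (Fin n) ℂ) (α : Fin n → ℂ)
    (m : Fin n →₀ ℕ) :
    polyDCoeff g α (MvPolynomial.monomial m 1) =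
      falling (shift α fun j => m j) m * g (shift α fun j => m j) := by
  have h : MvPolynomial.monomial m (1 : ℂ) = MvPolynomial.basisMonomials (Fin n) ℂ m := by
    rw [MvPolynomial.coe_basisMonomials]
  rw [h, polyDCoeff, Module.Basis.constr_basis]

theorem weylAction_polyD_logSeries {n : ℕ} (q : MvPolynomial (Fin n) ℂ)
    (g : (Fin n → ℂ) → MvPowerSeries (Fin n) ℂ) (p : MvPolynomial (Fin n) ℂ) :
    weylAction n (polyD p) (logSeries q g) = logSeries q fun α => polyDCoeff g α p := by
  funext α
  have hp : polyDCoeff g α p = ∑ m ∈ p.support, p.coeff m •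
      polyDCoeff g α (MvPolynomial.monomial m 1) := by
    conv_lhs => rw [p.as_sum, map_sum]
    refine Finset.sum_congr rfl fun m _ => ?_
    rw [← map_smul, MvPolynomial.smul_monomial, smul_eq_mul, mul_one]
  change _ = logPoly q (polyDCoeff g α p)
  rw [hp, polyD, map_sum, map_sum, LinearMap.sum_apply, Finset.sum_apply]
  refine Finset.sum_congr rfl fun m _ => ?_
  rw [map_smul, map_smul, map_list_prod, List.ofFn_eq_map, List.map_map]
  have hmap : (⇑(weylAction n) ∘ fun j => (wd j : Weyl n) ^ m j) = fun j => derivX j ^ m j := by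
    funext j
    rw [Function.comp_apply, map_pow, weylAction_wd]
  rw [hmap, LinearMap.smul_apply, Pi.smul_apply,
    list_prod_derivX_logSeries q g m _ (List.nodup_finRange n), polyDCoeff_monomial]
  have hsum : α + ((List.finRange n).map fun j => Pi.single j (m j : ℂ)).sum =
      shift α fun j => m j := by
    rw [← List.ofFn_eq_map, List.sum_ofFn]
    funext i
    rw [Finset.univ_sum_single fun j => (m j : ℂ)]
    simp [shift]
  change _ • logPoly q _ = _
  beta_reduce
  rw [hsum, ← List.ofFn_eq_map, List.prod_ofFn]
  simp [falling, shift]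

theorem polyDCoeff_monomial_mul {n : ℕ} (g : (Fin n → ℂ) → MvPowerSeries (Fin n) ℂ)
    (α : Fin n → ℂ) (c : Fin n →₀ ℕ) (p : MvPolynomial (Fin n) ℂ) :
    polyDCoeff g α (MvPolynomial.monomial c 1 * p) =
      falling (shift α fun j => c j) c * polyDCoeff g (shift α fun j => c j) p := by
  have h : polyDCoeff g α ∘ₗ LinearMap.mulLeft ℂ (MvPolynomial.monomial c 1) =
      LinearMap.mulLeft ℂ (falling (shift α fun j => c j) c) ∘ₗ
        polyDCoeff g (shift α fun j => c j) := by
    refine (MvPolynomial.basisMonomials (Fin n) ℂ).ext fun m => ?_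
    rw [MvPolynomial.coe_basisMonomials]
    simp only [LinearMap.comp_apply, LinearMap.mulLeft_apply, MvPolynomial.monomial_mul, one_mul,
      polyDCoeff_monomial, shift_shift]
    have hadd : ((fun j => (c j : ℤ)) + fun j => (m j : ℤ)) = fun j => ((c + m) j : ℤ) :=
      funext fun j => by simp
    have hback : (((fun j => (c j : ℤ)) + fun j => (m j : ℤ)) + fun j => -(m j : ℤ)) =
        fun j => (c j : ℤ) := funext fun j => by simp
    have hfall := falling_add (shift α ((fun j => (c j : ℤ)) + fun j => (m j : ℤ))) m c
    rw [shift_shift, hback, add_comm (m : Fin n → ℕ)] at hfall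
    rw [← hadd, Finsupp.coe_add, hfall]
    ring
  exact LinearMap.congr_fun h p

/-- If the binomials `∂^a - ∂^b` in the toric ideal send all coefficients into `P`, so do all
elements of the toric ideal. -/
theorem polyDCoeff_mem {d n : ℕ} (A : Matrix (Fin d) (Fin n) ℤ)
    (g : (Fin n → ℂ) → MvPowerSeries (Fin n) ℂ) (P : Ideal (MvPowerSeries (Fin n) ℂ))
    (h : ∀ a b : Fin n →₀ ℕ,
      A.mulVec (fun j => (a j : ℤ)) = A.mulVec (fun j => (b j : ℤ)) → ∀ α,
      polyDCoeff g α (MvPolynomial.monomial a 1 - MvPolynomial.monomial b 1) ∈ P)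
    {p : MvPolynomial (Fin n) ℂ} (hp : p ∈ toricIdeal A) (α : Fin n → ℂ) :
    polyDCoeff g α p ∈ P := by
  revert α
  refine Submodule.closure_induction
    (p := fun p _ => ∀ α, polyDCoeff g α p ∈ P) ?_ ?_ ?_ hp
  · intro α
    rw [map_zero]
    exact zero_mem _
  · intro x y _ _ hx hy α
    rw [map_add]
    exact add_mem (hx α) (hy α)
  · rintro c _ ⟨a, b, hab, rfl⟩ α
    rw [smul_eq_mul, c.as_sum, Finset.sum_mul, map_sum]
    refine Submodule.sum_mem _ fun m _ => ?_
    have hm : MvPolynomial.monomial m (c.coeff m) =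
        c.coeff m • MvPolynomial.monomial m (1 : ℂ) := by
      rw [MvPolynomial.smul_monomial, smul_eq_mul, mul_one]
    rw [hm, smul_mul_assoc, map_smul, polyDCoeff_monomial_mul, MvPowerSeries.smul_eq_C_mul]
    exact P.mul_mem_left _ (P.mul_mem_left _ (h a b hab _))

theorem weylAction_eulerOp_logSeries {d n : ℕ} (A : Matrix (Fin d) (Fin n) ℤ) (β : Fin d → ℂ)
    (i : Fin d) (q : MvPolynomial (Fin n) ℂ) (g : (Fin n → ℂ) → MvPowerSeries (Fin n) ℂ) :
    weylAction n (eulerOp A β i) (logSeries q g) = logSeries q fun α =>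
      linForm A i * g α + ((∑ j, (A i j : ℂ) * α j) - β i) • g α := by
  funext α
  have hj : ∀ j, weylAction n (wx j * wd j) (logSeries q g) α =
      logPoly q ((MvPowerSeries.X j + MvPowerSeries.C (α j)) * g α) := fun j => by
    rw [map_mul, weylAction_wx, weylAction_wd, Module.End.mul_apply, derivX_logSeries]
    change logPoly q _ = _
    simp only [Pi.sub_apply, Pi.single_eq_same, sub_add_cancel]
  rw [eulerOp, map_sub, map_sum, LinearMap.sub_apply, LinearMap.sum_apply, Pi.sub_apply,
    Finset.sum_apply]
  simp only [map_smul, LinearMap.smul_apply, Pi.smul_apply, hj, AlgHom.commutes,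
    Module.algebraMap_end_apply]
  change _ - β i • logPoly q (g α) = logPoly q _
  simp only [← map_smul, ← map_sum, ← map_sub]
  congr 1
  simp only [linForm, MvPowerSeries.smul_eq_C_mul, map_sub, map_sum, map_mul, add_mul, sub_mul,
    Finset.sum_mul, mul_add, mul_assoc, Finset.sum_add_distrib]
  ring

theorem isHypergeometric_of_generators {d n : ℕ} {A : Matrix (Fin d) (Fin n) ℤ} {β : Fin d → ℂ}
    {φ : LogSeries n} (htoric : ∀ p ∈ toricIdeal A, weylAction n (polyD p) φ = 0)
    (heuler : ∀ i, weylAction n (eulerOp A β i) φ = 0) : IsHypergeometric A β φ := by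
  intro D hD
  refine Submodule.span_induction (p := fun D _ => weylAction n D φ = 0) ?_ ?_ ?_ ?_ hD
  · rintro _ (⟨p, hp, rfl⟩ | ⟨i, rfl⟩)
    · exact htoric p hp
    · exact heuler i
  · rw [map_zero, LinearMap.zero_apply]
  · intro x y _ _ hx hy
    rw [map_add, LinearMap.add_apply, hx, hy, add_zero]
  · intro a x _ hx
    rw [smul_eq_mul, map_mul, Module.End.mul_apply, hx, map_zero]

/-! ### The perturbed series modulo `P` and `Q` -/

open Classical in
/-- The coefficient of `x^{α + t}` in the perturbed series: `t^{I₀ ∖ K} a_u(t)` if `α = v + u` with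
`u ∈ L` and `nsupp (v + u) ∈ 𝒩'`, and `0` otherwise. -/
def pertCoeffAt {d n : ℕ} (A : Matrix (Fin d) (Fin n) ℤ) (v : Fin n → ℂ)
    (N' : Set (Finset (Fin n))) (α : Fin n → ℂ) : MvPowerSeries (Fin n) ℂ :=
  if h : ∃ u ∈ lattice A, α = shift v u ∧ nsupp (shift v u) ∈ N' then
    pertCoeff (commonPart N') v h.choose
  else 0

theorem frobSeries_eq_logSeries {d n : ℕ} (A : Matrix (Fin d) (Fin n) ℤ) (v : Fin n → ℂ)
    (N' : Set (Finset (Fin n))) (q : MvPolynomial (Fin n) ℂ) :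
    frobSeries A v N' q = logSeries q (pertCoeffAt A v N') := by
  funext α
  rw [frobSeries, pertSeries, logSeries, pertCoeffAt]
  split_ifs with h
  · rfl
  · rw [evalDiff_zero, map_zero]

theorem pertCoeffAt_shift {d n : ℕ} {A : Matrix (Fin d) (Fin n) ℤ} {v : Fin n → ℂ}
    {N' : Set (Finset (Fin n))} {u : Fin n → ℤ} (hu : u ∈ lattice A)
    (hI : nsupp (shift v u) ∈ N') :
    pertCoeffAt A v N' (shift v u) = pertCoeff (commonPart N') v u := by
  have h : ∃ u' ∈ lattice A, shift v u = shift v u' ∧ nsupp (shift v u') ∈ N' :=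
    ⟨u, hu, rfl, hI⟩
  rw [pertCoeffAt, dif_pos h, ← shift_injective v h.choose_spec.2.1]

theorem pertCoeffAt_of_notMem {d n : ℕ} {A : Matrix (Fin d) (Fin n) ℤ} {v : Fin n → ℂ}
    {N' : Set (Finset (Fin n))} {α : Fin n → ℂ} (hI : nsupp α ∉ N') :
    pertCoeffAt A v N' α = 0 := by
  rw [pertCoeffAt, dif_neg]
  rintro ⟨u, _, rfl, h⟩
  exact hI h

theorem pertCoeffAt_of_not_exists {d n : ℕ} {A : Matrix (Fin d) (Fin n) ℤ} {v : Fin n → ℂ}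
    {N' : Set (Finset (Fin n))} {α : Fin n → ℂ} (h : ¬ ∃ u ∈ lattice A, α = shift v u) :
    pertCoeffAt A v N' α = 0 := by
  rw [pertCoeffAt, dif_neg]
  rintro ⟨u, hu, rfl, _⟩
  exact h ⟨u, hu, rfl⟩

theorem commonPart_subset {n : ℕ} {N' : Set (Finset (Fin n))} {I : Finset (Fin n)} (hI : I ∈ N') :
    commonPart N' ⊆ I := by
  classical
  intro j hj
  rw [commonPart, Finset.mem_filter] at hj
  exact hj.2 I hI

/-- A term of `∂^a` applied to the perturbed series whose partner under `∂^b` is missing from it,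
because its negative support lies outside `𝒩'`, has its coefficient in `P`. -/
theorem falling_mul_pertCoeff_mem_idealP {d n : ℕ} {A : Matrix (Fin d) (Fin n) ℤ}
    {v₀ v : Fin n → ℂ} {N' : Set (Finset (Fin n))} {u u' : Fin n → ℤ} (a b : Fin n →₀ ℕ)
    (hab : ∀ j, u j - a j = u' j - b j) (hI : nsupp (shift v u) ∈ N')
    (hJ : nsupp (shift v u') ∈ NS A v₀ \ N') :
    falling (shift v u) a * pertCoeff (commonPart N') v u ∈ idealP A v₀ N' := by
  refine Ideal.mem_of_dvd _ (tpow_union_dvd_falling_mul_pertCoeff (J := nsupp (shift v u'))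
    (commonPart_subset hI) a fun j hj => ?_) (Ideal.subset_span ⟨_, hI, _, hJ, rfl⟩)
  obtain ⟨k, hk, hk'⟩ := mem_nsupp.mp hj
  refine mem_nsupp.mpr ⟨k - b j, by omega, ?_⟩
  rw [Int.cast_sub, ← hk']
  simp only [shift, hab j, Int.cast_sub, Int.cast_natCast]
  ring

theorem add_mem_lattice {d n : ℕ} {A : Matrix (Fin d) (Fin n) ℤ} {u u' : Fin n → ℤ}
    (hu : u ∈ lattice A) (hu' : u' ∈ lattice A) : u + u' ∈ lattice A := by
  change A.mulVec (u + u') = 0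
  rw [Matrix.mulVec_add, show A.mulVec u = 0 from hu, show A.mulVec u' = 0 from hu', add_zero]

theorem polyDCoeff_binomial_mem_idealP {d n : ℕ} {A : Matrix (Fin d) (Fin n) ℤ}
    {v₀ : Fin n → ℂ} {u₀ : Fin n → ℤ} (hu₀ : u₀ ∈ lattice A) (N' : Set (Finset (Fin n)))
    (a b : Fin n →₀ ℕ)
    (hab : A.mulVec (fun j => (a j : ℤ)) = A.mulVec (fun j => (b j : ℤ))) (α : Fin n → ℂ) :
    polyDCoeff (pertCoeffAt A (shift v₀ u₀) N') α
      (MvPolynomial.monomial a 1 - MvPolynomial.monomial b 1) ∈ idealP A v₀ N' := by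
  rw [map_sub, polyDCoeff_monomial, polyDCoeff_monomial]
  set v := shift v₀ u₀ with hv
  have hNS : ∀ u ∈ lattice A, nsupp (shift v u) ∈ NS A v₀ := fun u hu =>
    ⟨u₀ + u, add_mem_lattice hu₀ hu, by rw [hv, shift_shift]⟩
  -- `α + a` and `α + b` lie in `v + L` simultaneously.
  have hpartner : ∀ a b : Fin n →₀ ℕ,
      A.mulVec (fun j => (a j : ℤ)) = A.mulVec (fun j => (b j : ℤ)) → ∀ u ∈ lattice A,
      shift α (fun j => a j) = shift v u → ∃ u' ∈ lattice A,
        shift α (fun j => b j) = shift v u' ∧ ∀ j, u j - a j = u' j - b j := by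
    intro a b hab u hu hα
    refine ⟨u + ((fun j => (b j : ℤ)) - fun j => (a j : ℤ)), add_mem_lattice hu ?_, ?_, ?_⟩
    · change A.mulVec (_ - _) = 0
      rw [Matrix.mulVec_sub, hab, sub_self]
    · rw [← shift_shift, ← hα, shift_shift]
      congr 1
      funext j
      simp
    · intro j
      simp only [Pi.add_apply, Pi.sub_apply]
      ring
  by_cases hex : ∃ u ∈ lattice A, shift α (fun j => a j) = shift v u
  · obtain ⟨u, hu, hα⟩ := hex
    obtain ⟨u', hu', hα', huu'⟩ := hpartner a b hab u hu hα
    rw [hα, hα']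
    by_cases hI : nsupp (shift v u) ∈ N' <;> by_cases hI' : nsupp (shift v u') ∈ N'
    · rw [pertCoeffAt_shift hu hI, pertCoeffAt_shift hu' hI', falling_mul_pertCoeff_eq
        (commonPart_subset hI) (commonPart_subset hI') a b huu', sub_self]
      exact zero_mem _
    · rw [pertCoeffAt_shift hu hI, pertCoeffAt_of_notMem hI', mul_zero, sub_zero]
      exact falling_mul_pertCoeff_mem_idealP a b huu' hI ⟨hNS u' hu', hI'⟩
    · rw [pertCoeffAt_shift hu' hI', pertCoeffAt_of_notMem hI, mul_zero, zero_sub]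
      exact neg_mem (falling_mul_pertCoeff_mem_idealP b a (fun j => (huu' j).symm) hI'
        ⟨hNS u hu, hI⟩)
    · rw [pertCoeffAt_of_notMem hI, pertCoeffAt_of_notMem hI', mul_zero, mul_zero, sub_self]
      exact zero_mem _
  · have hex' : ¬ ∃ u ∈ lattice A, shift α (fun j => b j) = shift v u := by
      rintro ⟨u, hu, hα⟩
      obtain ⟨u', hu', hα', _⟩ := hpartner b a hab.symm u hu hα
      exact hex ⟨u', hu', hα'⟩
    rw [pertCoeffAt_of_not_exists hex, pertCoeffAt_of_not_exists hex', mul_zero, mul_zero,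
      sub_self]
    exact zero_mem _

theorem sum_mul_shift {d n : ℕ} {A : Matrix (Fin d) (Fin n) ℤ} {u : Fin n → ℤ}
    (hu : u ∈ lattice A) (v : Fin n → ℂ) (i : Fin d) :
    ∑ j, (A i j : ℂ) * shift v u j = ∑ j, (A i j : ℂ) * v j := by
  have h : ∑ j, A i j * u j = 0 := congrFun (show A.mulVec u = 0 from hu) i
  have h' : ∑ j, (A i j : ℂ) * (u j : ℂ) = 0 := by exact_mod_cast congrArg (Int.cast (R := ℂ)) h
  simp only [shift, mul_add, Finset.sum_add_distrib, h', add_zero]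

theorem euler_mem_eulerIdeal {d n : ℕ} {A : Matrix (Fin d) (Fin n) ℤ} {β : Fin d → ℂ}
    {v : Fin n → ℂ} (hv : ∀ i, ∑ j, (A i j : ℂ) * v j = β i) (N' : Set (Finset (Fin n)))
    (i : Fin d) (α : Fin n → ℂ) :
    linForm A i * pertCoeffAt A v N' α +
      ((∑ j, (A i j : ℂ) * α j) - β i) • pertCoeffAt A v N' α ∈ eulerIdeal A N' := by
  by_cases h : ∃ u ∈ lattice A, α = shift v u ∧ nsupp (shift v u) ∈ N'
  · obtain ⟨u, hu, rfl, hI⟩ := h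
    rw [sum_mul_shift hu, hv, sub_self, zero_smul, add_zero, pertCoeffAt_shift hu hI]
    exact Ideal.mem_of_dvd _ (mul_dvd_mul_left _ (tpow_dvd_pertCoeff (commonPart_subset hI)))
      (Ideal.subset_span ⟨i, _, hI, rfl⟩)
  · rw [pertCoeffAt, dif_neg h, mul_zero, smul_zero, add_zero]
    exact zero_mem _

theorem isHypergeometric_frobSeries {d n : ℕ} {A : Matrix (Fin d) (Fin n) ℤ} {β : Fin d → ℂ}
    {v₀ : Fin n → ℂ} (hv₀ : ∀ i, ∑ j, (A i j : ℂ) * v₀ j = β i) {u₀ : Fin n → ℤ}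
    (hu₀ : u₀ ∈ lattice A) {N' : Set (Finset (Fin n))} {q : MvPolynomial (Fin n) ℂ}
    (hq : q ∈ perp (idealQ A v₀ N')) :
    IsHypergeometric A β (frobSeries A (shift v₀ u₀) N' q) := by
  rw [frobSeries_eq_logSeries]
  refine isHypergeometric_of_generators (fun p hp => ?_) fun i => ?_
  · rw [weylAction_polyD_logSeries]
    exact funext fun α => logPoly_eq_zero hq (Ideal.mem_sup_right
      (polyDCoeff_mem A _ _ (polyDCoeff_binomial_mem_idealP hu₀ N') hp α))
  · rw [weylAction_eulerOp_logSeries]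
    exact funext fun α => logPoly_eq_zero hq (Ideal.mem_sup_left
      (euler_mem_eulerIdeal (fun i => (sum_mul_shift hu₀ v₀ i).trans (hv₀ i)) N' i α))

theorem frobSeries_self {d n : ℕ} {A : Matrix (Fin d) (Fin n) ℤ} {v : Fin n → ℂ}
    {N' : Set (Finset (Fin n))} (hI : nsupp v ∈ N') (q : MvPolynomial (Fin n) ℂ) :
    frobSeries A v N' q v = logPoly q (tpow (nsupp v \ commonPart N')) := by
  have h := pertCoeffAt_shift (A := A) (v := v) (N' := N') (u := 0) (Matrix.mulVec_zero A)
    (by rwa [shift_zero])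
  rw [shift_zero, pertCoeff_zero (commonPart_subset hI)] at h
  rw [frobSeries_eq_logSeries, logSeries, h]

end AHyp

end

theorem mainTheorem4 {d n : ℕ} (A : Matrix (Fin d) (Fin n) ℤ)
    (hrank : (A.map (Int.cast : ℤ → ℚ)).rank = d) (hhom : AHyp.IsHomogeneous A)
    (β : Fin d → ℂ) (w : Fin n → ℝ) (hw : AHyp.IsGenericWeight A w)
    (v₀ v : Fin n → ℂ) (hv₀ : AHyp.IsFakeExponent A β w v₀)
    (hv : AHyp.IsMinimalWeightVector A w v₀ v)
    (N' : Set (Finset (Fin n))) (hN' : N' ⊆ AHyp.minNS A w v₀) :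
    AHyp.perp (AHyp.idealQ A v₀ N') =
        AHyp.perp (AHyp.eulerIdeal A N') ∩ AHyp.perp (AHyp.idealP A v₀ N') ∧
      (∀ q ∈ AHyp.perp (AHyp.idealQ A v₀ N'),
        AHyp.IsHypergeometric A β (AHyp.frobSeries A v N' q)) ∧
      (AHyp.nsupp v ∈ N' →
        {r : MvPolynomial (Fin n) ℂ | ∃ q ∈ AHyp.perp (AHyp.idealQ A v₀ N'),
            r = AHyp.frobSeries A v N' q v} =
          AHyp.perp ((AHyp.idealQ A v₀ N').colon
            {AHyp.tpow (AHyp.nsupp v \ AHyp.commonPart N')})) := by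
  obtain ⟨u₀, hu₀, rfl, _⟩ := hv
  refine ⟨AHyp.perp_sup _ _, fun q hq => AHyp.isHypergeometric_frobSeries hv₀.1 hu₀ hq,
    fun hI => ?_⟩
  simp only [AHyp.frobSeries_self hI]
  exact AHyp.setOf_logPoly_eq_perp_colon
    (fun f hf k => AHyp.homogeneousComponent_mem_idealQ A v₀ N' hf k) (AHyp.isHomogeneous_tpow _)
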